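/- Let $\xi_0,\xi_1,\dots$ be nondegenerate (not almost surely constant) i.i.d. complex random variables with $\mathbb P(\xi_0=0)=0$ and $\mathbb E\log(1+|\xi_0|)<\infty$. Let $p:[0,\infty)\to[0,\infty)$ be a function, $T_0\in(0,\infty)$, $(L_n)$ a sequence of positive integers with $L_n\to\infty$, and $(\delta_n)$ a sequence in $(-T_0,T_0)$ with $\delta_n\to0$, such that $(T_0-\delta_n)L_n$ is an integer for every $n$. Let $p_{k,n}$ be deterministic complex coefficients. Assume that 1. $p(t)>0$ for $t\in[0,T_0)$ and $p(t)=0$ for $t>T_0$; 2. the restriction of $p$ to $[0,T_0]$ is continuous; 3. $\displaystyle\lim_{n\to\infty}\ \sup_{0\le k\le (T_0-\delta_n)L_n}\Big|\,|p_{k,n}|^{1/L_n}-p\big(\min\{k/L_n,\,T_0\}\big)\Big|=0.$ Consider the random polynomials $$F_n(z)=\sum_{k=0}^{(T_0-\delta_n)L_n}\xi_k\,p_{k,n}\,z^k ,$$ let $\mu_{F_n}=\sum_{z:\,F_n(z)=0}\delta_z$ be the measure of zeros of $F_n$, counted with multiplicity, and let $I(s)=\sup_{t\ge0}\,(st+\log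 p(t))$, $s\in\mathbb R$ (with $\log 0=-\infty$), be the Legendre–Fenchel transform of $-\log p$. Then $I$ is finite, and there is a deterministic rotationally invariant measure $\mu$ on $\mathbb C$ with $$\mu(\{z\in\mathbb C: |z|<r\})=I'(\log r)\qquad\text{for all } r>0,$$ where $I'$ is the left derivative of $I$, such that $\frac1{L_n}\mu_{F_n}$ converges to $\mu$ in probability: for every smooth compactly supported function $\varphi:\mathbb C\to\mathbb R$, $\frac1{L_n}\int\varphi\,d\mu_{F_n}\to\int\varphi\,d\mu$ in probability as $n\to\infty$. (For the at most finitely many $n$ for which $F_n$ may vanish identically with positive probability, $\mu_{F_n}$ is set to be $0$ where $F_n\equiv0$.) -/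

import Mathlib

open MeasureTheory ProbabilityTheory Filter Topology Polynomial
open scoped NNReal ENNReal

noncomputable section

/-- The random polynomial `∑_{k = 0}^{d} ξ_k c_k z^k`, at the sample point `ω`. -/
def randomPoly {Ω : Type*} (ξ : ℕ → Ω → ℂ) (c : ℕ → ℂ) (d : ℕ) (ω : Ω) : ℂ[X] :=
  ∑ k ∈ Finset.range (d + 1), Polynomial.C (ξ k ω * c k) * Polynomial.X ^ k

/-- The measure of zeros `∑_{z : q(z) = 0} δ_z`, zeros being counted with multiplicity. -/
def zeroMeasure (q : ℂ[X]) : Measure ℂ :=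
  (q.roots.map Measure.dirac).sum

/-- The Legendre–Fenchel transform `f^*(s) = sup_{t ≥ 0} (s t - f(t))` of an extended-real valued
function `f` on `[0, ∞)`. -/
def legendreFenchel (f : ℝ≥0 → EReal) (s : ℝ) : EReal :=
  ⨆ t : ℝ≥0, (((s * (t : ℝ) : ℝ) : EReal) - f t)

/-- The function `-log p`, with the convention `log 0 = -∞`. -/
def negLog (p : ℝ≥0 → ℝ≥0) (t : ℝ≥0) : EReal :=
  -ENNReal.log (p t : ℝ≥0∞)

/-- A measure on `ℂ` is rotationally invariant if it is invariant under multiplication by every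
complex number of modulus one. -/
def IsRotationInvariant (μ : Measure ℂ) : Prop :=
  ∀ w : ℂ, ‖w‖ = 1 → μ.map (fun z => w * z) = μ

/-- Convergence in probability of random measures `ν n ω` on `ℂ` to a deterministic measure `μ`:
for every smooth compactly supported test function `φ`, the random variables `∫ φ dν_n` converge
in probability to `∫ φ dμ`. -/
def ConvergesInProbability {Ω : Type*} [MeasurableSpace Ω] (P : Measure Ω)
    (ν : ℕ → Ω → Measure ℂ) (μ : Measure ℂ) : Prop :=
  ∀ φ : ℂ → ℝ, ContDiff ℝ (⊤ : ℕ∞) φ → HasCompactSupport φ →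
    TendstoInMeasure P (fun n ω => ∫ z, φ z ∂(ν n ω)) atTop (fun _ => ∫ z, φ z ∂μ)

end

/-! The zeros of a polynomial `q` are, up to a factor `2π`, the Laplacian of the potential `log
‖q‖`. So the theorem is about potentials: with probability tending to one, `(L n)⁻¹ log ‖F_n‖` is
close in `L¹` of discs to `U z = I (log ‖z‖)`, and `μ` is the Riesz measure of `U`.

Upper bound: the logarithmic moment keeps all `ξ k` with `k ≤ D n` below `exp (ε L n)`
(`tendsto_measure_exists_exp_lt`), and the largest monomial is about `exp (L n * I (log ‖z‖))` by
the definition of the Legendre transform (`CoeffAsymptotics.eventually_norm_mul_pow_le`).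

Lower bound: near `a ≠ 0`, a block of `m` consecutive monomials almost attains this maximum. If
`F_n` were exponentially too small at `m` fixed points near `a`, then, given the other coefficients,
inverting a Vandermonde matrix would confine each `ξ k` of the block to a small disc. By
nondegeneracy and independence this has probability at most `q ^ m` with `q < 1`
(`CoeffAsymptotics.tendsto_measure_forall_norm_le`). One good point near each centre of a fine cover
is enough: the sub-mean value property and the upper bound then give `L¹` closeness
(`setIntegral_abs_log_sub_le`).

From potentials to zeros: the Laplacian is replaced by the difference operator `meanDefect r` at a
fixed scale `r`. It is symmetric (`integral_meanDefect_mul`), kills constants, and turns `log ‖· -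
w‖` into a nonnegative kernel that vanishes at distance `r` or more from `w`. Pairing `meanDefect r
φ` with `log ‖q‖` therefore gives the sum of `φ` over the zeros, up to the mass of the kernel and
the oscillation of `φ` at scale `r`; continuity of `φ` suffices. Convexity of `I` provides a finite
measure `ν` on the line whose distribution function is the left derivative of `I`, and the same
computation on circles identifies the measure belonging to `U` as `radialMeasure ν`. -/

/-! ### Integrals of `log ‖z - w‖` over discs -/

theorem polarCoord_symm_eq_circleMap (p : ℝ × ℝ) :
    Complex.polarCoord.symm p = circleMap 0 p.1 p.2 := by
  simp [circleMap, Complex.exp_mul_I]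

theorem integrableOn_log_norm_ball_zero (R : ℝ) :
    IntegrableOn (fun z : ℂ => Real.log ‖z‖) (Metric.ball 0 R) := by
  have hmeas : Measurable (fun z : ℂ => Real.log ‖z‖) := by fun_prop
  refine ⟨hmeas.aestronglyMeasurable, ?_⟩
  rw [hasFiniteIntegral_iff_enorm, ← lintegral_indicator Metric.isOpen_ball.measurableSet,
    ← Complex.lintegral_comp_polarCoord_symm]
  -- The Jacobian tames the singularity: `r |log r|` is below `1` for `r ≤ 1` and below `r ^ 2` for
  -- `r ≥ 1`.
  have hbound : ∀ p ∈ polarCoord.target, ENNReal.ofReal p.1 •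
      (Metric.ball (0 : ℂ) R).indicator (fun z : ℂ => ‖Real.log ‖z‖‖ₑ) (Complex.polarCoord.symm p) ≤
      (Set.Ioo (0 : ℝ) R ×ˢ Set.Ioo (-Real.pi) Real.pi).indicator
        (fun _ => ENNReal.ofReal (1 + R ^ 2)) p := by
    rintro ⟨r, θ⟩ hp
    simp only [polarCoord_target, Set.mem_prod, Set.mem_Ioi] at hp
    have hn : ‖Complex.polarCoord.symm (r, θ)‖ = r := by
      rw [Complex.norm_polarCoord_symm, abs_of_pos hp.1]
    by_cases hr : r < R
    · rw [Set.indicator_of_mem (by rw [mem_ball_zero_iff, hn]; exact hr),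
        Set.indicator_of_mem (by exact ⟨⟨hp.1, hr⟩, hp.2⟩), hn, smul_eq_mul,
        Real.enorm_eq_ofReal_abs, ← ENNReal.ofReal_mul hp.1.le]
      apply ENNReal.ofReal_le_ofReal
      rcases le_total r 1 with h | h
      · have := Real.abs_log_mul_self_lt r hp.1 h
        rw [abs_mul, abs_of_pos hp.1] at this
        nlinarith [sq_nonneg R]
      · rw [abs_of_nonneg (Real.log_nonneg h)]
        have := Real.log_le_sub_one_of_pos hp.1
        nlinarith
    · rw [Set.indicator_of_notMem (by rw [mem_ball_zero_iff, hn]; exact hr)]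
      simp
  calc _ ≤ _ := setLIntegral_mono' polarCoord.open_target.measurableSet hbound
    _ ≤ ∫⁻ p, (Set.Ioo (0 : ℝ) R ×ˢ Set.Ioo (-Real.pi) Real.pi).indicator
        (fun _ => ENNReal.ofReal (1 + R ^ 2)) p := setLIntegral_le_lintegral _ _
    _ < ∞ := by
      rw [lintegral_indicator (measurableSet_Ioo.prod measurableSet_Ioo), setLIntegral_const,
        Measure.volume_eq_prod, Measure.prod_prod]
      simp [ENNReal.mul_lt_top_iff]

theorem integrableOn_log_norm_sub (a w : ℂ) (R : ℝ) :
    IntegrableOn (fun z : ℂ => Real.log ‖z - w‖) (Metric.ball a R) := by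
  have h := (integrableOn_log_norm_ball_zero (R + ‖a - w‖))
  have hp : MeasurePreserving (fun z : ℂ => z - w) volume volume := measurePreserving_sub_right _ w
  have h2 := (hp.integrableOn_comp_preimage (MeasurableEquiv.subRight w).measurableEmbedding).2 h
  refine h2.mono_set ?_
  intro z hz
  simp only [Metric.mem_ball, Set.mem_preimage, dist_eq_norm, sub_zero] at hz ⊢
  calc ‖z - w‖ = ‖(z - a) + (a - w)‖ := by ring_nf
    _ ≤ _ := norm_add_le _ _
    _ < _ := by linarith

theorem setIntegral_ball_eq_integral_circleAverage {f : ℂ → ℝ} {R : ℝ} (hm : Measurable f)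
    (hf : IntegrableOn f (Metric.ball 0 R)) :
    ∫ z in Metric.ball 0 R, f z =
      ∫ t in Set.Ioo 0 R, 2 * Real.pi * t * Real.circleAverage f 0 t := by
  set g := (Metric.ball (0 : ℂ) R).indicator f with hg
  have hgm : Measurable g := hm.indicator Metric.isOpen_ball.measurableSet
  have hgi : Integrable g := hf.integrable_indicator Metric.isOpen_ball.measurableSet
  have hint : IntegrableOn (fun p : ℝ × ℝ => p.1 • g (Complex.polarCoord.symm p))
      polarCoord.target := by
    have hpm : Measurable (fun p : ℝ × ℝ => Complex.polarCoord.symm p) := by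
      simp only [polarCoord_symm_eq_circleMap, circleMap]
      fun_prop
    refine ⟨(measurable_fst.smul (hgm.comp hpm)).aestronglyMeasurable, ?_⟩
    have h1 := hgi.2
    rw [hasFiniteIntegral_iff_enorm] at h1 ⊢
    rw [← Complex.lintegral_comp_polarCoord_symm] at h1
    refine lt_of_le_of_lt (setLIntegral_mono' polarCoord.open_target.measurableSet ?_) h1
    rintro ⟨r, θ⟩ hp
    simp only [polarCoord_target, Set.mem_prod, Set.mem_Ioi] at hp
    rw [enorm_smul, smul_eq_mul, Real.enorm_of_nonneg hp.1.le]
  rw [← integral_indicator Metric.isOpen_ball.measurableSet, ← hg,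
    ← Complex.integral_comp_polarCoord_symm]
  rw [polarCoord_target, Measure.volume_eq_prod] at hint ⊢
  rw [setIntegral_prod _ hint, ← integral_indicator measurableSet_Ioi,
    ← integral_indicator measurableSet_Ioo]
  congr 1
  ext r
  by_cases h0 : 0 < r
  swap
  · rw [Set.indicator_of_notMem (by simpa using h0), Set.indicator_of_notMem (by simp [h0])]
  rw [Set.indicator_of_mem (by simpa using h0)]
  have hn : ∀ θ, ‖circleMap 0 r θ‖ = r := fun θ => by simp [abs_of_pos h0]
  by_cases h1 : r < R
  · rw [Set.indicator_of_mem (by simp [h0, h1]), Real.circleAverage_def]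
    have : ∀ θ, g (circleMap 0 r θ) = f (circleMap 0 r θ) := fun θ =>
      Set.indicator_of_mem (by rw [mem_ball_zero_iff, hn]; exact h1) _
    simp_rw [polarCoord_symm_eq_circleMap, this]
    rw [integral_smul, ← integral_Ioc_eq_integral_Ioo, ← intervalIntegral.integral_of_le
      (by linarith [Real.pi_pos])]
    -- Polar coordinates use angles in `(-π, π)`, circle averages use `[0, 2π]`.
    have hper : Function.Periodic (fun θ => f (circleMap 0 r θ)) (2 * Real.pi) := fun θ => by
      simp only [periodic_circleMap 0 r θ]
    have := hper.intervalIntegral_add_eq (-Real.pi) 0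
    rw [zero_add, show -Real.pi + 2 * Real.pi = Real.pi by ring] at this
    rw [this]
    simp only [smul_eq_mul]
    field_simp
  · rw [Set.indicator_of_notMem (by simp [h1])]
    have : ∀ θ, g (circleMap 0 r θ) = 0 := fun θ =>
      Set.indicator_of_notMem (by rw [mem_ball_zero_iff, hn]; exact h1) _
    simp_rw [polarCoord_symm_eq_circleMap, this]
    simp

/-- Jensen's formula for a single zero, written symmetrically in the two radii. It is applied below
both to discs and to rotationally invariant measures. -/
theorem circleAverage_log_norm_sub {t : ℝ} (ht : 0 < t) (w : ℂ) :
    Real.circleAverage (fun z => Real.log ‖z - w‖) 0 t = Real.log (max t ‖w‖) := by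
  rw [circleAverage_log_norm_sub_const_eq_log_radius_add_posLog ht.ne', zero_sub, norm_neg]
  rcases le_or_gt ‖w‖ t with h | h
  · rw [max_eq_left h, Real.posLog_eq_zero_iff _ |>.2, add_zero]
    rw [abs_of_nonneg (by positivity)]
    exact inv_mul_le_one_of_le₀ h ht.le
  · have hw : 0 < ‖w‖ := ht.trans h
    rw [max_eq_right h.le, Real.posLog_eq_log, Real.log_mul (by positivity) hw.ne', Real.log_inv]
    · ring
    · rw [abs_of_nonneg (by positivity), inv_mul_eq_div, one_le_div ht]
      exact h.le

/-- The excess of the integral of `log ‖· - v‖` over the disc of radius `r` centred at the origin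
over the value predicted by the mean value property. -/
noncomputable def logDefect (r : ℝ) (v : ℂ) : ℝ :=
  (∫ z in Metric.ball 0 r, Real.log ‖z - v‖) - Real.pi * r ^ 2 * Real.log ‖v‖

theorem setIntegral_ball_log_norm_sub (a w : ℂ) (r : ℝ) :
    ∫ z in Metric.ball a r, Real.log ‖z - w‖ = ∫ z in Metric.ball 0 r, Real.log ‖z - (w - a)‖ := by
  have hp : MeasurePreserving (fun z : ℂ => z + a) volume volume := measurePreserving_add_right _ a
  rw [← hp.setIntegral_preimage_emb (MeasurableEquiv.addRight a).measurableEmbedding]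
  congr 2
  · ext z; simp [dist_eq_norm]
  · ext z; ring_nf

/-- Polar coordinates and Jensen's formula. The integrand is nonnegative for `v ≠ 0` and vanishes as
long as `t ≤ ‖v‖`, so sign and support of the kernel can be read off. -/
theorem logDefect_eq {r : ℝ} (hr : 0 < r) (v : ℂ) :
    logDefect r v = ∫ t in Set.Ioo 0 r,
      2 * Real.pi * t * (Real.log (max t ‖v‖) - Real.log ‖v‖) := by
  have hm : Measurable (fun z : ℂ => Real.log ‖z - v‖) := by fun_prop
  have h1 : IntegrableOn (fun t => 2 * Real.pi * t * Real.log ‖v‖) (Set.Ioo 0 r) :=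
    (Continuous.integrableOn_Icc (by fun_prop)).mono_set Set.Ioo_subset_Icc_self
  have h2 : IntegrableOn (fun t => 2 * Real.pi * t * Real.log (max t ‖v‖)) (Set.Ioo 0 r) := by
    refine IntegrableOn.mono_set ?_ Set.Ioo_subset_Icc_self
    refine ContinuousOn.integrableOn_Icc ?_
    -- At `v = 0` the integrand is a multiple of `t log t`, still continuous thanks to the value
    -- `log 0 = 0`.
    rcases eq_or_ne v 0 with rfl | hv
    · refine ContinuousOn.congr (f := fun t => 2 * Real.pi * (t * Real.log t)) ?_ ?_
      · exact (Real.continuous_mul_log.const_mul _).continuousOn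
      · intro t ht
        simp only [norm_zero, max_eq_left ht.1]
        ring
    · refine Continuous.continuousOn (Continuous.mul (by fun_prop) ?_)
      refine Continuous.log (by fun_prop) fun t => ?_
      exact (lt_max_of_lt_right (norm_pos_iff.2 hv)).ne'
  have h3 : Real.pi * r ^ 2 * Real.log ‖v‖ = ∫ t in Set.Ioo 0 r, 2 * Real.pi * t * Real.log ‖v‖ := by
    rw [← integral_Ioc_eq_integral_Ioo, ← intervalIntegral.integral_of_le hr.le]
    rw [intervalIntegral.integral_mul_const, intervalIntegral.integral_const_mul, integral_id]
    ring
  rw [logDefect, setIntegral_ball_eq_integral_circleAverage hm (integrableOn_log_norm_sub 0 v r),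
    h3, setIntegral_congr_fun measurableSet_Ioo (fun t ht => by
      rw [circleAverage_log_norm_sub ht.1]), ← integral_sub h2 h1]
  simp only [mul_sub]

theorem logDefect_nonneg {r : ℝ} (hr : 0 < r) {v : ℂ} (hv : v ≠ 0) : 0 ≤ logDefect r v := by
  rw [logDefect_eq hr]
  refine setIntegral_nonneg measurableSet_Ioo fun t ht => ?_
  have : Real.log ‖v‖ ≤ Real.log (max t ‖v‖) :=
    Real.log_le_log (by simpa using hv) (le_max_right _ _)
  have := ht.1
  have := Real.pi_pos
  exact mul_nonneg (by positivity) (by linarith)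

theorem logDefect_eq_zero {r : ℝ} (hr : 0 < r) {v : ℂ} (hv : r ≤ ‖v‖) : logDefect r v = 0 := by
  rw [logDefect_eq hr, setIntegral_congr_fun (g := fun _ => (0 : ℝ)) measurableSet_Ioo]
  · simp
  · intro t ht
    simp only
    rw [max_eq_right (ht.2.le.trans hv)]
    simp

theorem log_le_setIntegral_ball_log {r : ℝ} (hr : 0 < r) {a w : ℂ} (h : a ≠ w) :
    Real.pi * r ^ 2 * Real.log ‖a - w‖ ≤ ∫ z in Metric.ball a r, Real.log ‖z - w‖ := by
  have := logDefect_nonneg hr (sub_ne_zero.2 h.symm)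
  rw [logDefect, ← setIntegral_ball_log_norm_sub, norm_sub_rev w a] at this
  linarith

theorem measure_ball_toReal (a : ℂ) {r : ℝ} (hr : 0 ≤ r) :
    (volume (Metric.ball a r)).toReal = Real.pi * r ^ 2 := by
  rw [Complex.volume_ball]
  simp [ENNReal.toReal_ofReal hr]
  ring

theorem logDefect_pos {r : ℝ} {v : ℂ} (hv : v ≠ 0) (hvr : ‖v‖ < r) : 0 < logDefect r v := by
  have hr : 0 < r := (norm_nonneg v).trans_lt hvr
  have hv' : 0 < ‖v‖ := norm_pos_iff.2 hv
  rw [logDefect_eq hr]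
  have hcont : Continuous fun t : ℝ => 2 * Real.pi * t * (Real.log (max t ‖v‖) - Real.log ‖v‖) := by
    refine Continuous.mul (by fun_prop) (Continuous.sub ?_ continuous_const)
    exact Continuous.log (by fun_prop) fun t => (lt_max_of_lt_right hv').ne'
  have hpi := Real.pi_pos
  rw [setIntegral_pos_iff_support_of_nonneg_ae]
  · refine lt_of_lt_of_le ?_ (measure_mono (s := Set.Ioo ‖v‖ r) ?_)
    · simpa using hvr
    · intro t ht
      have ht0 : 0 < t := hv'.trans ht.1
      refine ⟨ne_of_gt ?_, ht0, ht.2⟩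
      simp only [max_eq_left ht.1.le]
      have := Real.log_lt_log hv' ht.1
      exact mul_pos (by positivity) (by linarith)
  · refine (ae_restrict_iff' measurableSet_Ioo).2 (ae_of_all _ fun t ht => ?_)
    have : Real.log ‖v‖ ≤ Real.log (max t ‖v‖) := Real.log_le_log hv' (le_max_right _ _)
    have := ht.1
    exact mul_nonneg (by positivity) (by linarith)
  · exact hcont.integrableOn_Icc.mono_set Set.Ioo_subset_Icc_self

/-! ### Symmetry of disc averages and of the mean defect -/

section Fubini

variable {φ h : ℂ → ℝ} {R r : ℝ}

/-- The relation `dist z a < r` is symmetric in `a` and `z`. Since `φ` will live in `‖a‖ < R`,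
cutting `h` off at radius `R + r` loses nothing, and it makes Fubini available for an `h` that is
only locally integrable. -/
theorem integrable_prod_mul_indicator_dist (hφ : Integrable φ)
    (hh : IntegrableOn h (Metric.ball 0 (R + r))) :
    Integrable (fun x : ℂ × ℂ => {x : ℂ × ℂ | dist x.2 x.1 < r}.indicator
      (fun x => φ x.1 * (Metric.ball (0 : ℂ) (R + r)).indicator h x.2) x) (volume.prod volume) := by
  refine Integrable.indicator ?_ ?_
  · exact hφ.mul_prod (hh.integrable_indicator Metric.isOpen_ball.measurableSet)
  · exact (isOpen_lt (by fun_prop) continuous_const).measurableSet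

theorem integral_prod_indicator_left (hsupp : ∀ a, R ≤ ‖a‖ → φ a = 0) (a : ℂ) :
    ∫ z, {x : ℂ × ℂ | dist x.2 x.1 < r}.indicator
      (fun x => φ x.1 * (Metric.ball (0 : ℂ) (R + r)).indicator h x.2) (a, z) =
      φ a * ∫ z in Metric.ball a r, h z := by
  rw [← integral_const_mul, ← integral_indicator Metric.isOpen_ball.measurableSet]
  congr 1
  ext z
  by_cases hz : dist z a < r
  · rw [Set.indicator_of_mem (by exact hz),
      Set.indicator_of_mem (s := Metric.ball a r) (by exact hz)]
    by_cases ha : R ≤ ‖a‖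
    · simp [hsupp a ha]
    · rw [Set.indicator_of_mem]
      rw [mem_ball_zero_iff]
      rw [dist_eq_norm] at hz
      have := norm_le_norm_add_norm_sub a z
      rw [norm_sub_rev a z] at this
      push Not at ha
      linarith
  · rw [Set.indicator_of_notMem (by exact hz), Set.indicator_of_notMem (by exact hz)]

theorem integral_prod_indicator_right (hsupp : ∀ a, R ≤ ‖a‖ → φ a = 0) (z : ℂ) :
    ∫ a, {x : ℂ × ℂ | dist x.2 x.1 < r}.indicator
      (fun x => φ x.1 * (Metric.ball (0 : ℂ) (R + r)).indicator h x.2) (a, z) =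
      (∫ a in Metric.ball z r, φ a) * h z := by
  rw [← integral_mul_const, ← integral_indicator Metric.isOpen_ball.measurableSet]
  congr 1
  ext a
  by_cases hz : dist z a < r
  · rw [Set.indicator_of_mem (by exact hz),
      Set.indicator_of_mem (s := Metric.ball z r) (by rwa [Metric.mem_ball'])]
    by_cases ha : R ≤ ‖a‖
    · simp [hsupp a ha]
    · rw [Set.indicator_of_mem]
      rw [mem_ball_zero_iff]
      rw [dist_eq_norm] at hz
      have := norm_le_norm_add_norm_sub a z
      rw [norm_sub_rev a z] at this
      push Not at ha
      linarith
  · rw [Set.indicator_of_notMem (by exact hz),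
      Set.indicator_of_notMem (by rwa [Metric.mem_ball'])]

theorem integrable_mul_setIntegral_ball (hφ : Integrable φ) (hsupp : ∀ a, R ≤ ‖a‖ → φ a = 0)
    (hh : IntegrableOn h (Metric.ball 0 (R + r))) :
    Integrable (fun a => φ a * ∫ z in Metric.ball a r, h z) := by
  have := (integrable_prod_mul_indicator_dist (R := R) (r := r) hφ hh).integral_prod_left
  simpa only [integral_prod_indicator_left hsupp] using this

theorem integrable_setIntegral_ball_mul (hφ : Integrable φ) (hsupp : ∀ a, R ≤ ‖a‖ → φ a = 0)
    (hh : IntegrableOn h (Metric.ball 0 (R + r))) :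
    Integrable (fun z => (∫ a in Metric.ball z r, φ a) * h z) := by
  have := (integrable_prod_mul_indicator_dist (R := R) (r := r) hφ hh).integral_prod_right
  simpa only [integral_prod_indicator_right hsupp] using this

theorem integral_mul_setIntegral_ball (hφ : Integrable φ) (hsupp : ∀ a, R ≤ ‖a‖ → φ a = 0)
    (hh : IntegrableOn h (Metric.ball 0 (R + r))) :
    ∫ a, φ a * ∫ z in Metric.ball a r, h z = ∫ z, (∫ a in Metric.ball z r, φ a) * h z := by
  have := integral_integral_swap (f := fun a z => {x : ℂ × ℂ | dist x.2 x.1 < r}.indicator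
      (fun x => φ x.1 * (Metric.ball (0 : ℂ) (R + r)).indicator h x.2) (a, z))
      (integrable_prod_mul_indicator_dist (R := R) (r := r) hφ hh)
  simpa only [integral_prod_indicator_right hsupp, integral_prod_indicator_left hsupp] using this

end Fubini

/-- The difference between the integral of `φ` over the disc of radius `r` centred at `z` and the
value predicted by the mean value property. -/
noncomputable def meanDefect (r : ℝ) (φ : ℂ → ℝ) (z : ℂ) : ℝ :=
  (∫ a in Metric.ball z r, φ a) - Real.pi * r ^ 2 * φ z

section MeanDefect

variable {φ h : ℂ → ℝ} {R r : ℝ}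

theorem meanDefect_eq_zero (hr : 0 ≤ r) (hsupp : ∀ a, R ≤ ‖a‖ → φ a = 0) {z : ℂ}
    (hz : R + r ≤ ‖z‖) : meanDefect r φ z = 0 := by
  rw [meanDefect, hsupp z (by linarith), setIntegral_congr_fun (g := fun _ => (0 : ℝ))
    Metric.isOpen_ball.measurableSet]
  · simp
  · intro a ha
    apply hsupp
    rw [Metric.mem_ball, dist_eq_norm] at ha
    have := norm_le_norm_add_norm_sub z a
    rw [norm_sub_rev z a] at this
    linarith [norm_le_norm_add_norm_sub' z a, norm_sub_rev z a]

theorem integrable_mul_of_bounded (hφ : Continuous φ) (hsupp : ∀ a, R ≤ ‖a‖ → φ a = 0)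
    (hh : IntegrableOn h (Metric.ball 0 R)) : Integrable (fun z => φ z * h z) := by
  have hcs : HasCompactSupport φ := HasCompactSupport.intro (isCompact_closedBall (0 : ℂ) R)
    fun x hx => hsupp x (by simpa using (not_le.1 (by simpa using hx)).le)
  obtain ⟨C, hC⟩ := hcs.exists_bound_of_continuous hφ
  have := (hh.integrable_indicator Metric.isOpen_ball.measurableSet).bdd_mul
    hφ.aestronglyMeasurable (ae_of_all _ hC)
  refine this.congr (ae_of_all _ fun z => ?_)
  by_cases hz : R ≤ ‖z‖
  · simp [hsupp z hz]
  · simp only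
    rw [Set.indicator_of_mem (by simpa using hz)]

theorem integrable_of_bounded (hφ : Continuous φ) (hsupp : ∀ a, R ≤ ‖a‖ → φ a = 0) :
    Integrable φ := by
  have := integrable_mul_of_bounded (h := fun _ => 1) hφ hsupp
    (integrableOn_const measure_ball_lt_top.ne)
  simpa using this

theorem integrable_meanDefect_mul (hr : 0 ≤ r) (hφ : Continuous φ)
    (hsupp : ∀ a, R ≤ ‖a‖ → φ a = 0) (hh : IntegrableOn h (Metric.ball 0 (R + r))) :
    Integrable (fun z => meanDefect r φ z * h z) := by
  have h1 := integrable_setIntegral_ball_mul (integrable_of_bounded hφ hsupp) hsupp hh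
  have h2 := (integrable_mul_of_bounded hφ hsupp (hh.mono_set
    (Metric.ball_subset_ball (by linarith)))).const_mul (Real.pi * r ^ 2)
  refine (h1.sub h2).congr (ae_of_all _ fun z => ?_)
  simp only [meanDefect, Pi.sub_apply]
  ring

/-- The analogue of Green's second identity: the operator moves from the test function to the
potential, with no derivatives involved. -/
theorem integral_meanDefect_mul (hr : 0 ≤ r) (hφ : Continuous φ)
    (hsupp : ∀ a, R ≤ ‖a‖ → φ a = 0) (hh : IntegrableOn h (Metric.ball 0 (R + r))) :
    ∫ z, meanDefect r φ z * h z = ∫ a, φ a * meanDefect r h a := by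
  have hi := integrable_of_bounded hφ hsupp
  have h1 := integrable_setIntegral_ball_mul hi hsupp hh
  have h1' := integrable_mul_setIntegral_ball hi hsupp hh
  have h2 := (integrable_mul_of_bounded hφ hsupp (hh.mono_set
    (Metric.ball_subset_ball (by linarith)))).const_mul (Real.pi * r ^ 2)
  have e1 : (fun z => meanDefect r φ z * h z) = fun z => (∫ a in Metric.ball z r, φ a) * h z -
      Real.pi * r ^ 2 * (φ z * h z) := by
    ext z; simp only [meanDefect]; ring
  have e2 : (fun z => φ z * meanDefect r h z) = fun z => φ z * (∫ a in Metric.ball z r, h a) -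
      Real.pi * r ^ 2 * (φ z * h z) := by
    ext z; simp only [meanDefect]; ring
  rw [e1, e2, integral_sub h1 h2, integral_sub h1' h2, integral_mul_setIntegral_ball hi hsupp hh]

/-- By symmetry, because constants have no mean defect. Additive constants in potentials are
therefore invisible. -/
theorem integral_meanDefect (hr : 0 ≤ r) (hφ : Continuous φ)
    (hsupp : ∀ a, R ≤ ‖a‖ → φ a = 0) : ∫ z, meanDefect r φ z = 0 := by
  have := integral_meanDefect_mul (h := fun _ => 1) hr hφ hsupp
    (integrableOn_const measure_ball_lt_top.ne)
  simp only [mul_one] at this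
  rw [this]
  have : ∀ a, meanDefect r (fun _ => (1 : ℝ)) a = 0 := by
    intro a
    rw [meanDefect, integral_const, smul_eq_mul, Measure.real, Measure.restrict_apply_univ,
      measure_ball_toReal _ hr, sub_self]
  simp [this]

theorem meanDefect_log_norm_sub (w a : ℂ) :
    meanDefect r (fun z => Real.log ‖z - w‖) a = logDefect r (w - a) := by
  rw [meanDefect, logDefect, setIntegral_ball_log_norm_sub, norm_sub_rev a w]

end MeanDefect

/-! ### The kernel `logDefect r` as an approximate identity -/

theorem integrable_logDefect {r : ℝ} (hr : 0 < r) : Integrable (logDefect r) := by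
  have h1 : Integrable ((Metric.ball (0 : ℂ) r).indicator (fun _ => (1 : ℝ))) :=
    (integrableOn_const measure_ball_lt_top.ne).integrable_indicator
      Metric.isOpen_ball.measurableSet
  have hlog := integrableOn_log_norm_sub 0 0 (r + r)
  have h2 := integrable_mul_setIntegral_ball (R := r) (r := r) h1
    (fun a ha => Set.indicator_of_notMem (by simpa using ha) _) hlog
  have h3 := ((integrableOn_log_norm_sub 0 0 r).integrable_indicator
    Metric.isOpen_ball.measurableSet).const_mul (Real.pi * r ^ 2)
  -- The reflection appears because averaging `log ‖z‖` over the disc around `-v` is averaging `log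
  -- ‖z - v‖` over the disc around `0`.
  refine (h2.sub h3).comp_neg.congr (ae_of_all _ fun v => ?_)
  by_cases hv : v ∈ Metric.ball (0 : ℂ) r
  · have hv' : -v ∈ Metric.ball (0 : ℂ) r := by simpa using hv
    simp only [Pi.sub_apply, Set.indicator_of_mem hv', logDefect, one_mul,
      setIntegral_ball_log_norm_sub (-v)]
    simp
  · have hv' : -v ∉ Metric.ball (0 : ℂ) r := by simpa using hv
    simp only [Pi.sub_apply, Set.indicator_of_notMem hv']
    rw [logDefect_eq_zero hr (by simpa using hv)]
    simp

theorem logDefect_nonneg_ae {r : ℝ} (hr : 0 < r) : ∀ᵐ v : ℂ, 0 ≤ logDefect r v := by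
  filter_upwards [Measure.ae_ne volume (0 : ℂ)] with v hv using logDefect_nonneg hr hv

theorem integral_logDefect_pos {r : ℝ} (hr : 0 < r) : 0 < ∫ v, logDefect r v := by
  rw [integral_pos_iff_support_of_nonneg_ae (logDefect_nonneg_ae hr) (integrable_logDefect hr)]
  refine lt_of_lt_of_le ?_ (measure_mono (s := Metric.ball (0 : ℂ) r \ {0}) ?_)
  · rw [measure_sdiff_null (by simp)]
    exact Metric.measure_ball_pos _ _ hr
  · intro v hv
    exact (logDefect_pos hv.2 (by simpa using hv.1)).ne'

/-- By symmetry the integral is the convolution of `φ` with `logDefect r` at `w`. The kernel is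
nonnegative almost everywhere and vanishes outside the disc of radius `r`, where `φ` differs from `φ
w` by at most `ε`. -/
theorem abs_integral_meanDefect_mul_log_sub_le {φ : ℂ → ℝ} {R r ε : ℝ} (hr : 0 < r)
    (hφ : Continuous φ) (hsupp : ∀ a, R ≤ ‖a‖ → φ a = 0)
    (hosc : ∀ a b, dist a b < r → |φ a - φ b| ≤ ε) (w : ℂ) :
    |(∫ z, meanDefect r φ z * Real.log ‖z - w‖) - (∫ v, logDefect r v) * φ w| ≤
      ε * ∫ v, logDefect r v := by
  have hD := integrable_logDefect hr
  have hcs : HasCompactSupport φ := HasCompactSupport.intro (isCompact_closedBall (0 : ℂ) R)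
    fun x hx => hsupp x (by simpa using (not_le.1 (by simpa using hx)).le)
  obtain ⟨C, hC⟩ := hcs.exists_bound_of_continuous hφ
  have h1 : Integrable fun v => φ (w - v) * logDefect r v :=
    hD.bdd_mul (by fun_prop) (ae_of_all _ fun v => hC (w - v))
  rw [integral_meanDefect_mul hr.le hφ hsupp (integrableOn_log_norm_sub 0 w _)]
  simp_rw [meanDefect_log_norm_sub]
  rw [← integral_sub_left_eq_self _ volume w]
  simp_rw [sub_sub_cancel]
  rw [← integral_mul_const, ← integral_sub h1 (hD.mul_const _), ← integral_const_mul]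
  rw [← Real.norm_eq_abs]
  refine norm_integral_le_of_norm_le (hD.const_mul _) ?_
  filter_upwards [logDefect_nonneg_ae hr] with v hv
  rw [mul_comm (logDefect r v), ← sub_mul, norm_mul, Real.norm_eq_abs, Real.norm_eq_abs,
    abs_of_nonneg hv]
  rcases le_or_gt r ‖v‖ with h | h
  · simp [logDefect_eq_zero hr h]
  · exact mul_le_mul_of_nonneg_right (hosc _ _ (by simpa [dist_eq_norm] using h)) hv

/-! ### The potential of a polynomial and its zeros -/

theorem log_norm_eval_eq {q : ℂ[X]} {z : ℂ} (hz : q.eval z ≠ 0) :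
    Real.log ‖q.eval z‖ = Real.log ‖q.leadingCoeff‖ +
      (q.roots.map fun w => Real.log ‖z - w‖).sum := by
  have h := (IsAlgClosed.splits q).eval_eq_prod_roots z
  have hne : ∀ w ∈ q.roots, z - w ≠ 0 := by
    intro w hw h0
    rw [sub_eq_zero] at h0
    exact hz (h0 ▸ (mem_roots'.1 hw).2)
  have key : ∀ s : Multiset ℂ, (∀ w ∈ s, z - w ≠ 0) →
      (s.map fun w => z - w).prod ≠ 0 ∧ Real.log ‖(s.map fun w => z - w).prod‖ =
        (s.map fun w => Real.log ‖z - w‖).sum := by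
    intro s
    induction s using Multiset.induction_on with
    | empty => simp
    | cons a s ih =>
      intro hs
      obtain ⟨h1, h2⟩ := ih fun w hw => hs w (Multiset.mem_cons_of_mem hw)
      have ha := hs a (Multiset.mem_cons_self a s)
      simp only [Multiset.map_cons, Multiset.prod_cons, Multiset.sum_cons]
      refine ⟨mul_ne_zero ha h1, ?_⟩
      rw [norm_mul, Real.log_mul (by simpa using ha) (by simpa using h1), h2]
  obtain ⟨h1, h2⟩ := key q.roots hne
  rw [h, norm_mul, Real.log_mul _ (by simpa using h1), h2]
  rw [norm_ne_zero_iff, leadingCoeff_ne_zero]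
  rintro rfl
  simp at hz

theorem ae_eval_ne_zero {q : ℂ[X]} (hq : q ≠ 0) : ∀ᵐ z : ℂ, q.eval z ≠ 0 := by
  have : {z : ℂ | ¬ q.eval z ≠ 0} ⊆ (q.roots.toFinset : Set ℂ) := by
    intro z hz
    simp only [ne_eq, not_not, Set.mem_ofPred_eq] at hz
    simp [hq, hz]
  exact measure_mono_null this (Finset.measure_zero _ _)

theorem integrable_multiset_sum {α ι : Type*} [MeasurableSpace α] {μ : Measure α} {f : ι → α → ℝ}
    (hf : ∀ i, Integrable (f i) μ) (s : Multiset ι) :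
    Integrable (fun x => (s.map fun i => f i x).sum) μ ∧
      ∫ x, (s.map fun i => f i x).sum ∂μ = (s.map fun i => ∫ x, f i x ∂μ).sum := by
  induction s using Multiset.induction_on with
  | empty => simp
  | cons a s ih =>
    simp only [Multiset.map_cons, Multiset.sum_cons]
    exact ⟨(hf a).add ih.1, by rw [integral_add (hf a) ih.1, ih.2]⟩

theorem log_norm_eval_ae_eq {q : ℂ[X]} (hq : q ≠ 0) : ∀ᵐ z : ℂ,
    Real.log ‖q.eval z‖ = Real.log ‖q.leadingCoeff‖ +
      (q.roots.map fun w => Real.log ‖z - w‖).sum := by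
  filter_upwards [ae_eval_ne_zero hq] with z hz using log_norm_eval_eq hz

theorem integrableOn_log_norm_eval {q : ℂ[X]} (hq : q ≠ 0) (a : ℂ) (r : ℝ) :
    IntegrableOn (fun z => Real.log ‖q.eval z‖) (Metric.ball a r) := by
  have h := (integrable_multiset_sum (fun w => integrableOn_log_norm_sub a w r) q.roots).1
  have hc : IntegrableOn (fun _ : ℂ => Real.log ‖q.leadingCoeff‖) (Metric.ball a r) :=
    integrableOn_const measure_ball_lt_top.ne
  refine (hc.add h).congr ?_
  filter_upwards [ae_restrict_of_ae (log_norm_eval_ae_eq hq)] with z hz using hz.symm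

/-- The sub-mean value property of `log ‖q‖` on discs. -/
theorem log_norm_eval_le_setIntegral_ball {q : ℂ[X]} {a : ℂ} (ha : q.eval a ≠ 0) {r : ℝ}
    (hr : 0 < r) :
    Real.pi * r ^ 2 * Real.log ‖q.eval a‖ ≤ ∫ z in Metric.ball a r, Real.log ‖q.eval z‖ := by
  have hq : q ≠ 0 := by rintro rfl; simp at ha
  have hc : IntegrableOn (fun _ : ℂ => Real.log ‖q.leadingCoeff‖) (Metric.ball a r) :=
    integrableOn_const measure_ball_lt_top.ne
  obtain ⟨h1, h2⟩ := integrable_multiset_sum (fun w => integrableOn_log_norm_sub a w r) q.roots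
  rw [integral_congr_ae (ae_restrict_of_ae (log_norm_eval_ae_eq hq)), integral_add hc h1, h2,
    log_norm_eval_eq ha, mul_add, ← Multiset.sum_map_mul_left]
  have hvol : ∫ z in Metric.ball a r, Real.log ‖q.leadingCoeff‖ =
      Real.pi * r ^ 2 * Real.log ‖q.leadingCoeff‖ := by
    rw [integral_const, smul_eq_mul, Measure.real, Measure.restrict_apply_univ,
      measure_ball_toReal _ hr.le]
  rw [hvol]
  gcongr
  refine Multiset.sum_map_le_sum_map _ _ fun w hw => ?_
  refine log_le_setIntegral_ball_log hr ?_
  rintro rfl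
  exact ha (mem_roots'.1 hw).2

/-- The linear statistic of the zeros of `q` is determined, up to a small error, by the integral
of `log ‖q‖` against the mean defect of the test function. -/
theorem abs_integral_meanDefect_mul_log_eval_sub_le {φ : ℂ → ℝ} {R r ε : ℝ} (hr : 0 < r)
    (hφ : Continuous φ) (hsupp : ∀ a, R ≤ ‖a‖ → φ a = 0)
    (hosc : ∀ a b, dist a b < r → |φ a - φ b| ≤ ε) {q : ℂ[X]} (hq : q ≠ 0) :
    |(∫ z, meanDefect r φ z * Real.log ‖q.eval z‖) -
      (∫ v, logDefect r v) * (q.roots.map φ).sum| ≤ ε * (∫ v, logDefect r v) * q.natDegree := by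
  have hi : ∀ w : ℂ, Integrable fun z => meanDefect r φ z * Real.log ‖z - w‖ := fun w =>
    integrable_meanDefect_mul hr.le hφ hsupp (integrableOn_log_norm_sub 0 w _)
  obtain ⟨h1, h2⟩ := integrable_multiset_sum hi q.roots
  have h0 : Integrable fun z => meanDefect r φ z := by
    simpa using integrable_meanDefect_mul (h := fun _ => 1) hr.le hφ hsupp
      (integrableOn_const measure_ball_lt_top.ne)
  have e : ∫ z, meanDefect r φ z * Real.log ‖q.eval z‖ =
      (q.roots.map fun w => ∫ z, meanDefect r φ z * Real.log ‖z - w‖).sum := by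
    -- The leading coefficient contributes a constant, which drops out because the mean defect has
    -- integral zero.
    rw [← h2, integral_congr_ae (g := fun z => meanDefect r φ z * Real.log ‖q.leadingCoeff‖ +
      (q.roots.map fun w => meanDefect r φ z * Real.log ‖z - w‖).sum), integral_add
      (h0.mul_const _) h1, integral_mul_const, integral_meanDefect hr.le hφ hsupp]
    · simp
    · filter_upwards [log_norm_eval_ae_eq hq] with z hz
      rw [hz, mul_add, Multiset.sum_map_mul_left]
  rw [e, ← Multiset.sum_map_mul_left]
  have hcard : (q.roots.card : ℝ) ≤ q.natDegree := by exact_mod_cast q.card_roots'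
  have hε : 0 ≤ ε := (abs_nonneg _).trans (hosc 0 0 (by simpa using hr))
  have hc := integral_logDefect_pos hr
  refine le_trans ?_ (mul_le_mul_of_nonneg_left hcard (by positivity))
  generalize q.roots = s
  induction s using Multiset.induction_on with
  | empty => simp
  | cons a s ih =>
    simp only [Multiset.map_cons, Multiset.sum_cons, Multiset.card_cons, Nat.cast_add,
      Nat.cast_one]
    have := abs_integral_meanDefect_mul_log_sub_le hr hφ hsupp hosc a
    rw [abs_le] at this ih ⊢
    constructor <;> linarith [this.1, this.2, ih.1, ih.2]

theorem integral_zeroMeasure (φ : ℂ → ℝ) (q : ℂ[X]) :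
    ∫ z, φ z ∂(zeroMeasure q) = (q.roots.map φ).sum := by
  rw [zeroMeasure]
  have : ∀ s : Multiset ℂ, Integrable φ (s.map Measure.dirac).sum ∧
      ∫ z, φ z ∂(s.map Measure.dirac).sum = (s.map φ).sum := by
    intro s
    induction s using Multiset.induction_on with
    | empty => simp
    | cons a s ih =>
      simp only [Multiset.map_cons, Multiset.sum_cons]
      have ha : Integrable φ (Measure.dirac a) := integrable_dirac (by simp)
      exact ⟨ha.add_measure ih.1, by rw [integral_add_measure ha ih.1, ih.2, integral_dirac]⟩
  exact (this _).2

/-! ### The measure on the line attached to a convex function -/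

/-- The second derivative of a nondecreasing convex function which is bounded below and has
bounded slopes, as a finite measure. -/
theorem exists_measure_integral_Iio_eq {I : ℝ → ℝ} (hI : ConvexOn ℝ Set.univ I) {b C : ℝ}
    (hb : ∀ s, b ≤ I s) (hmono : Monotone I) (hC : ∀ s t, s ≤ t → I t - I s ≤ C * (t - s)) :
    ∃ ν : Measure ℝ, IsFiniteMeasure ν ∧
      ∀ s t, I t - I s = ∫ v in s..t, ν.real (Set.Iio v) := by
  set f' : ℝ → ℝ := fun x => derivWithin I (Set.Ioi x) x with hf'
  have hder : ∀ x, HasDerivWithinAt I (f' x) (Set.Ioi x) x := fun x =>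
    hI.hasDerivWithinAt_rightDeriv_of_mem_interior (by simp)
  have hf'mono : Monotone f' := by
    have := hI.monotoneOn_rightDeriv
    rwa [interior_univ, monotoneOn_univ] at this
  have hslope : ∀ x, Tendsto (slope I x) (𝓝[>] x) (𝓝 (f' x)) := fun x =>
    (hasDerivWithinAt_iff_tendsto_slope' (by simp)).1 (hder x)
  have h0 : ∀ x, 0 ≤ f' x := fun x => by
    refine ge_of_tendsto (hslope x) (eventually_mem_nhdsWithin.mono fun y hy => ?_)
    have hy : x < y := hy
    rw [slope_def_field]
    exact div_nonneg (by linarith [hmono hy.le]) (by linarith)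
  have h1 : ∀ x, f' x ≤ C := fun x => by
    refine le_of_tendsto (hslope x) (eventually_mem_nhdsWithin.mono fun y hy => ?_)
    have hy : x < y := hy
    rw [slope_def_field, div_le_iff₀ (by linarith)]
    exact hC _ _ hy.le
  have hcont : Continuous I := continuousOn_univ.1 (hI.continuousOn isOpen_univ)
  have hint : ∀ s t, ∫ v in s..t, f' v = I t - I s := fun s t =>
    intervalIntegral.integral_eq_sub_of_hasDeriv_right hcont.continuousOn
      (fun x _ => hder x) hf'mono.intervalIntegrable
  have hbdd : BddBelow (Set.range f') := ⟨0, by rintro _ ⟨x, rfl⟩; exact h0 x⟩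
  have hlim : Tendsto f' atBot (𝓝 0) := by
    have hl := tendsto_atBot_ciInf hf'mono hbdd
    suffices h : (⨅ i, f' i) = 0 by rwa [h] at hl
    refine le_antisymm ?_ (le_ciInf h0)
    -- A positive infimum `l` of the slopes would make `I` fall at rate at least `l` towards `-∞`;
    -- going left by `(I 0 - b + 1) / l` takes it below `b`.
    by_contra! hpos
    set l := ⨅ i, f' i
    have key : ∀ s ≤ 0, l * (0 - s) ≤ I 0 - I s := fun s hs => by
      rw [← hint]
      have : ∫ v in s..0, l = l * (0 - s) := by simp [mul_comm]
      rw [← this]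
      exact intervalIntegral.integral_mono_on hs (by simp) hf'mono.intervalIntegrable
        fun x _ => ciInf_le hbdd x
    have hnonneg : 0 ≤ I 0 - b := by linarith [hb 0]
    have := key (-((I 0 - b + 1) / l)) (by
      have : 0 ≤ (I 0 - b + 1) / l := by positivity
      linarith)
    rw [zero_sub, neg_neg, mul_div_cancel₀ _ hpos.ne'] at this
    linarith [hb (-((I 0 - b + 1) / l))]
  set F := hf'mono.stieltjesFunction with hF
  have hFle : ∀ x, f' x ≤ F x := fun x => by
    rw [hF, Monotone.stieltjesFunction_eq]; exact hf'mono.le_rightLim le_rfl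
  have hFge : ∀ x, F x ≤ f' (x + 1) := fun x => by
    rw [hF, Monotone.stieltjesFunction_eq]; exact hf'mono.rightLim_le (by linarith)
  have hFlim : Tendsto F atBot (𝓝 0) :=
    tendsto_of_tendsto_of_tendsto_of_le_of_le hlim
      (hlim.comp (tendsto_atBot_add_const_right _ 1 tendsto_id)) hFle hFge
  refine ⟨F.measure, F.isFiniteMeasure_of_forall_abs_le (C := C) fun x => ?_, fun s t => ?_⟩
  · rw [abs_of_nonneg ((h0 x).trans (hFle x))]
    exact (hFge x).trans (h1 _)
  · rw [← hint]
    -- The distribution function of the Stieltjes measure and `f'` can differ only at the countably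
    -- many jumps.
    apply intervalIntegral.integral_congr_ae
    have c1 : ∀ᵐ x : ℝ, ContinuousAt f' x :=
      hf'mono.countable_not_continuousAt.ae_notMem volume |>.mono fun x hx => not_not.1 hx
    have c2 : ∀ᵐ x : ℝ, Function.leftLim F x = F x :=
      F.countable_leftLim_ne.ae_notMem volume |>.mono fun x hx => not_not.1 hx
    filter_upwards [c1, c2] with x hx1 hx2 _
    rw [Measure.real, F.measure_Iio hFlim, hx2, hF, Monotone.stieltjesFunction_eq,
      hx1.continuousWithinAt.rightLim_eq, sub_zero, ENNReal.toReal_ofReal (h0 x)]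

section

variable {I : ℝ → ℝ} {ν : Measure ℝ} [IsFiniteMeasure ν]

theorem monotone_measureReal_Iio : Monotone fun v => ν.real (Set.Iio v) := fun _ _ h =>
  measureReal_mono (Set.Iio_subset_Iio h)

theorem tendsto_measureReal_Iio_nhdsLT (x : ℝ) :
    Tendsto (fun v => ν.real (Set.Iio v)) (𝓝[<] x) (𝓝 (ν.real (Set.Iio x))) := by
  have e : ∀ v, ν.real (Set.Iio v) = ∫ u, (Set.Iio v).indicator (fun _ => (1 : ℝ)) u ∂ν := fun v => by
    rw [integral_indicator measurableSet_Iio]; simp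
  simp_rw [e]
  refine tendsto_integral_filter_of_dominated_convergence (fun _ => 1) ?_ ?_
    (integrable_const _) ?_
  · exact Eventually.of_forall fun v =>
      (measurable_const.indicator measurableSet_Iio).aestronglyMeasurable
  · refine Eventually.of_forall fun v => ae_of_all _ fun u => ?_
    by_cases h : u < v <;> simp [Set.indicator, h]
  · refine ae_of_all _ fun u => tendsto_const_nhds.congr' ?_
    by_cases h : u < x
    · filter_upwards [Ioo_mem_nhdsLT h] with v hv
      simp [Set.indicator, h, hv.1]
    · filter_upwards [self_mem_nhdsWithin] with v hv
      have : ¬ u < v := fun h' => h (h'.trans hv)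
      simp [Set.indicator, h, this]

/-- The slope over `[y, x]` is a mean of a nondecreasing function, hence lies between its values at
the endpoints; left continuity of `v ↦ ν (-∞, v)` closes the gap. Open half-lines are what make the
left derivative appear. -/
theorem hasDerivWithinAt_Iio_of_integral_eq
    (hν : ∀ s t, I t - I s = ∫ v in s..t, ν.real (Set.Iio v)) (x : ℝ) :
    HasDerivWithinAt I (ν.real (Set.Iio x)) (Set.Iio x) x := by
  rw [hasDerivWithinAt_iff_tendsto_slope' (by simp)]
  refine tendsto_of_tendsto_of_tendsto_of_le_of_le' (tendsto_measureReal_Iio_nhdsLT x)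
    tendsto_const_nhds ?_ ?_
  all_goals
    filter_upwards [self_mem_nhdsWithin] with y hy
    have hy : y < x := hy
    rw [slope_comm, slope_def_field, hν]
  · rw [le_div_iff₀ (by linarith), mul_comm]
    calc _ = ∫ v in y..x, ν.real (Set.Iio y) := by simp
      _ ≤ _ := intervalIntegral.integral_mono_on hy.le (by simp)
        monotone_measureReal_Iio.intervalIntegrable fun v hv => monotone_measureReal_Iio hv.1
  · rw [div_le_iff₀ (by linarith), mul_comm]
    calc _ ≤ ∫ v in y..x, ν.real (Set.Iio x) :=
          intervalIntegral.integral_mono_on hy.le monotone_measureReal_Iio.intervalIntegrable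
            (by simp) fun v hv => monotone_measureReal_Iio hv.2
      _ = _ := by simp

/-- Layer cake: the integrand is the length of `(s, t] ∩ (u, ∞)`. With `u` the logarithm of a
radius, this writes `I`, up to a constant, as the radial logarithmic potential of `ν`. -/
theorem integral_max_sub_max
    (hν : ∀ s t, I t - I s = ∫ v in s..t, ν.real (Set.Iio v)) {s t : ℝ} (hst : s ≤ t) :
    ∫ u, (max t u - max s u) ∂ν = I t - I s := by
  have e : ∀ v, ν.real (Set.Iio v) =
      ∫ u, {x : ℝ × ℝ | x.2 < x.1}.indicator (fun _ => (1 : ℝ)) (v, u) ∂ν := fun v => by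
    rw [← integral_indicator_one measurableSet_Iio]
    rfl
  have hm : MeasurableSet {x : ℝ × ℝ | x.2 < x.1} :=
    (isOpen_lt continuous_snd continuous_fst).measurableSet
  rw [hν, intervalIntegral.integral_of_le hst]
  simp_rw [e]
  rw [integral_integral_swap]
  · congr 1
    ext u
    have : (fun v => {x : ℝ × ℝ | x.2 < x.1}.indicator (fun _ => (1 : ℝ)) (v, u)) =
        (Set.Ioi u).indicator 1 := rfl
    rw [this, integral_indicator_one measurableSet_Ioi, measureReal_restrict_apply measurableSet_Ioi,
      Set.inter_comm, Set.Ioc_inter_Ioi, Real.volume_real_Ioc]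
    rcases le_total s u with h1 | h1 <;> rcases le_total t u with h2 | h2 <;> simp [h1, h2] <;> grind
  · exact (integrable_const (1 : ℝ)).indicator hm

end

/-! ### The rotationally invariant limit measure and its potential -/

/-- The uniform probability measure on the angles `(0, 2π]`. -/
noncomputable def angleMeasure : Measure ℝ :=
  ENNReal.ofReal (2 * Real.pi)⁻¹ • volume.restrict (Set.Ioc 0 (2 * Real.pi))

instance : IsProbabilityMeasure angleMeasure := ⟨by
  rw [angleMeasure, Measure.smul_apply, Measure.restrict_apply_univ, Real.volume_Ioc, smul_eq_mul,
    ← ENNReal.ofReal_mul (by positivity), sub_zero, inv_mul_cancel₀ (by positivity),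
    ENNReal.ofReal_one]⟩

theorem integral_angleMeasure (f : ℂ → ℝ) (r : ℝ) :
    ∫ θ, f (circleMap 0 r θ) ∂angleMeasure = Real.circleAverage f 0 r := by
  rw [angleMeasure, integral_smul_measure, Real.circleAverage_def,
    intervalIntegral.integral_of_le (by positivity), ENNReal.toReal_ofReal (by positivity)]

/-- The rotationally invariant measure whose image under `log ‖·‖` is `ν`. -/
noncomputable def radialMeasure (ν : Measure ℝ) : Measure ℂ :=
  (ν.prod angleMeasure).map fun x => circleMap 0 (Real.exp x.1) x.2

theorem measurable_circleMap_exp :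
    Measurable fun x : ℝ × ℝ => circleMap 0 (Real.exp x.1) x.2 := by
  simp only [circleMap]
  fun_prop

theorem integrable_meanDefect {φ : ℂ → ℝ} {R r : ℝ} (hr : 0 ≤ r) (hφ : Continuous φ)
    (hsupp : ∀ a, R ≤ ‖a‖ → φ a = 0) : Integrable (meanDefect r φ) := by
  simpa using integrable_meanDefect_mul (h := fun _ => 1) hr hφ hsupp
    (integrableOn_const measure_ball_lt_top.ne)

theorem norm_meanDefect_le {φ : ℂ → ℝ} {C r : ℝ} (hr : 0 ≤ r) (hC : ∀ z, ‖φ z‖ ≤ C) (z : ℂ) :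
    ‖meanDefect r φ z‖ ≤ 2 * (Real.pi * r ^ 2) * C := by
  have h1 : ‖∫ a in Metric.ball z r, φ a‖ ≤ C * (Real.pi * r ^ 2) := by
    rw [← measure_ball_toReal z hr]
    exact norm_setIntegral_le_of_norm_le_const measure_ball_lt_top fun x _ => hC x
  have h2 : ‖Real.pi * r ^ 2 * φ z‖ ≤ Real.pi * r ^ 2 * C := by
    rw [norm_mul, Real.norm_of_nonneg (by positivity)]
    exact mul_le_mul_of_nonneg_left (hC z) (by positivity)
  rw [meanDefect]
  linarith [norm_sub_le (∫ a in Metric.ball z r, φ a) (Real.pi * r ^ 2 * φ z)]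

section Radial

variable {ν : Measure ℝ} [IsFiniteMeasure ν]

instance : IsFiniteMeasure (radialMeasure ν) := by
  rw [radialMeasure]; infer_instance

theorem integrable_circleAverage_exp {f : ℂ → ℝ} (hf : Continuous f) {C : ℝ} (hC : ∀ z, ‖f z‖ ≤ C) :
    Integrable (fun u => Real.circleAverage f 0 (Real.exp u)) ν ∧
    ∫ z, f z ∂(radialMeasure ν) = ∫ u, Real.circleAverage f 0 (Real.exp u) ∂ν := by
  have hm := measurable_circleMap_exp
  have hint : Integrable (fun x : ℝ × ℝ => f (circleMap 0 (Real.exp x.1) x.2))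
      (ν.prod angleMeasure) :=
    Integrable.of_bound (hf.measurable.comp hm).aestronglyMeasurable C (ae_of_all _ fun _ => hC _)
  rw [radialMeasure, integral_map hm.aemeasurable hf.aestronglyMeasurable, integral_prod _ hint]
  simp_rw [← integral_angleMeasure]
  exact ⟨hint.integral_prod_left, trivial⟩

theorem circleAverage_comp_mul {f : ℂ → ℝ} {w : ℂ} (hw : ‖w‖ = 1) (r : ℝ) :
    Real.circleAverage (fun z => f (w * z)) 0 r = Real.circleAverage f 0 r := by
  rw [Real.circleAverage_eq_integral_add (f := f) w.arg, Real.circleAverage_def]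
  congr 2
  ext θ
  congr 1
  conv_lhs => rw [← Complex.norm_mul_exp_arg_mul_I w, hw]
  simp only [circleMap, Complex.ofReal_add, add_mul, Complex.exp_add]
  push_cast
  ring

theorem isRotationInvariant_radialMeasure : IsRotationInvariant (radialMeasure ν) := by
  intro w hw
  have hm : Measurable fun z : ℂ => w * z := by fun_prop
  have : IsFiniteMeasure ((radialMeasure ν).map fun z => w * z) := inferInstance
  refine ext_of_forall_integral_eq_of_IsFiniteMeasure fun f => ?_
  rw [integral_map hm.aemeasurable f.continuous.aestronglyMeasurable,
    (integrable_circleAverage_exp (f := fun z => f (w * z)) (by fun_prop)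
      fun z => f.norm_coe_le_norm _).2,
    (integrable_circleAverage_exp f.continuous fun z => f.norm_coe_le_norm _).2]
  simp_rw [circleAverage_comp_mul hw]

omit [IsFiniteMeasure ν] in
theorem radialMeasure_ball {r : ℝ} (hr : 0 < r) :
    radialMeasure ν (Metric.ball 0 r) = ν (Set.Iio (Real.log r)) := by
  have : (fun x : ℝ × ℝ => circleMap 0 (Real.exp x.1) x.2) ⁻¹' Metric.ball 0 r =
      Set.Iio (Real.log r) ×ˢ Set.univ := by
    ext x
    simp [Real.lt_log_iff_exp_lt hr]
  rw [radialMeasure, Measure.map_apply measurable_circleMap_exp Metric.isOpen_ball.measurableSet,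
    this, Measure.prod_prod, measure_univ, mul_one]

theorem integrable_mul_of_bounded_of_support {g h : ℂ → ℝ} {C R : ℝ} (hg : AEStronglyMeasurable g)
    (hC : ∀ z, ‖g z‖ ≤ C) (hsupp : ∀ z, R ≤ ‖z‖ → g z = 0)
    (hh : IntegrableOn h (Metric.ball 0 R)) : Integrable (fun z => g z * h z) := by
  have := (hh.integrable_indicator Metric.isOpen_ball.measurableSet).bdd_mul hg (ae_of_all _ hC)
  refine this.congr (ae_of_all _ fun z => ?_)
  by_cases hz : R ≤ ‖z‖
  · simp [hsupp z hz]
  · simp only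
    rw [Set.indicator_of_mem (by simpa using hz)]

/-- Fubini needs a bound uniform in the angle. Translating by the point `w` of the circle moves the
singularity to the origin and the disc of radius `R` into the disc of radius `R + |ρ|`. -/
theorem integrable_prod_mul_log_norm_sub {g : ℂ → ℝ} {C R : ℝ} (hg : AEStronglyMeasurable g)
    (hC : ∀ z, ‖g z‖ ≤ C) (hsupp : ∀ z, R ≤ ‖z‖ → g z = 0) (ρ : ℝ) :
    Integrable (fun x : ℝ × ℂ => g x.2 * Real.log ‖x.2 - circleMap 0 ρ x.1‖)
      (angleMeasure.prod volume) := by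
  have hmeas : AEStronglyMeasurable
      (fun x : ℝ × ℂ => g x.2 * Real.log ‖x.2 - circleMap 0 ρ x.1‖)
      (angleMeasure.prod volume) := by
    refine hg.comp_snd.mul (Measurable.aestronglyMeasurable ?_)
    simp only [circleMap]
    fun_prop
  have hlog := fun w : ℂ => integrableOn_log_norm_sub 0 w R
  refine (integrable_prod_iff hmeas).2 ⟨ae_of_all _ fun θ => ?_, ?_⟩
  · exact integrable_mul_of_bounded_of_support hg hC hsupp (hlog (circleMap 0 ρ θ))
  · refine Integrable.of_bound hmeas.norm.integral_prod_right'
      (C * ∫ z in Metric.ball (0 : ℂ) (R + |ρ|), |Real.log ‖z‖|) (ae_of_all _ fun θ => ?_)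
    have hC0 : 0 ≤ C := (norm_nonneg _).trans (hC 0)
    have h1 := integrableOn_log_norm_sub 0 0 (R + |ρ|)
    simp only [sub_zero] at h1
    rw [Real.norm_of_nonneg (integral_nonneg fun _ => norm_nonneg _)]
    set w := circleMap 0 ρ θ
    calc ∫ z, ‖g z * Real.log ‖z - w‖‖
        ≤ ∫ z, C * (Metric.ball 0 R).indicator (fun z => |Real.log ‖z - w‖|) z := by
          refine integral_mono_of_nonneg (ae_of_all _ fun _ => norm_nonneg _)
            ((IntegrableOn.integrable_indicator (hlog w).norm
              Metric.isOpen_ball.measurableSet).const_mul C)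
            (ae_of_all _ fun z => ?_)
          simp only [norm_mul, Real.norm_eq_abs]
          by_cases hz : R ≤ ‖z‖
          · rw [hsupp z hz, abs_zero, zero_mul]
            exact mul_nonneg hC0 (Set.indicator_nonneg (fun _ _ => abs_nonneg _) _)
          · rw [Set.indicator_of_mem (by simpa using hz)]
            exact mul_le_mul_of_nonneg_right (hC z) (abs_nonneg _)
      _ = C * ∫ z in Metric.ball 0 R, |Real.log ‖z - w‖| := by
          rw [integral_const_mul, integral_indicator Metric.isOpen_ball.measurableSet]
      _ ≤ _ := by
          refine mul_le_mul_of_nonneg_left ?_ hC0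
          have hp : MeasurePreserving (fun z : ℂ => z + w) volume volume :=
            measurePreserving_add_right _ w
          rw [← hp.setIntegral_preimage_emb (MeasurableEquiv.addRight w).measurableEmbedding]
          simp only [add_sub_cancel_right]
          refine setIntegral_mono_set h1.norm (ae_of_all _ fun _ => abs_nonneg _)
            (LE.le.eventuallyLE fun z hz => ?_)
          have hz : ‖z + w‖ < R := mem_ball_zero_iff.1 hz
          change z ∈ Metric.ball (0 : ℂ) (R + |ρ|)
          rw [mem_ball_zero_iff]
          have hw : ‖w‖ = |ρ| := by simp [w]
          have : ‖z‖ ≤ ‖z + w‖ + ‖w‖ := by simpa using norm_sub_le (z + w) w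
          linarith

theorem circleAverage_integral_mul_log {g : ℂ → ℝ} {C R : ℝ} (hg : AEStronglyMeasurable g)
    (hC : ∀ z, ‖g z‖ ≤ C) (hsupp : ∀ z, R ≤ ‖z‖ → g z = 0) {ρ : ℝ} (hρ : 0 < ρ) :
    Real.circleAverage (fun w => ∫ z, g z * Real.log ‖z - w‖) 0 ρ =
      ∫ z, g z * Real.log (max ρ ‖z‖) := by
  have h := integrable_prod_mul_log_norm_sub hg hC hsupp ρ
  rw [← integral_angleMeasure]
  rw [integral_integral_swap h]
  congr 1
  ext z
  rw [integral_const_mul, ← circleAverage_log_norm_sub hρ, ← integral_angleMeasure]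
  simp_rw [norm_sub_rev z]

theorem abs_max_sub_max_zero_le (s u : ℝ) : |max s u - max 0 u| ≤ |s| := by
  simpa using abs_max_sub_max_le_abs s 0 u

/-- Off the origin, `log (max (exp u) ‖z‖) = max (log ‖z‖) u`. As `g` has integral zero, `max 0 u`
may be subtracted; the kernel is then bounded by `|log ‖z‖|` for all `u`, so `ν` needs no moments.
Layer cake yields `I (log ‖z‖) - I 0`, and the constant drops out again. -/
theorem integral_integral_mul_log_max {I : ℝ → ℝ}
    (hν : ∀ s t, I t - I s = ∫ v in s..t, ν.real (Set.Iio v))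
    {g : ℂ → ℝ} {C R : ℝ} (hg : AEStronglyMeasurable g)
    (hC : ∀ z, ‖g z‖ ≤ C) (hsupp : ∀ z, R ≤ ‖z‖ → g z = 0) (hg0 : ∫ z, g z = 0) :
    Integrable (fun u => ∫ z, g z * Real.log (max (Real.exp u) ‖z‖)) ν ∧
    Integrable (fun z => g z * I (Real.log ‖z‖)) ∧
    ∫ u, (∫ z, g z * Real.log (max (Real.exp u) ‖z‖)) ∂ν = ∫ z, g z * I (Real.log ‖z‖) := by
  have hlog := integrableOn_log_norm_sub 0 0 R
  simp only [sub_zero] at hlog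
  have hgi : Integrable g := by
    simpa using integrable_mul_of_bounded_of_support (h := fun _ => 1) hg hC hsupp
      (integrableOn_const measure_ball_lt_top.ne)
  have hgl := integrable_mul_of_bounded_of_support hg hC hsupp hlog
  have hK : Integrable (fun x : ℝ × ℂ => g x.2 * (max (Real.log ‖x.2‖) x.1 - max 0 x.1))
      (ν.prod volume) := by
    refine Integrable.mono ((integrable_const (1 : ℝ)).mul_prod hgl) ?_ (ae_of_all _ fun x => ?_)
    · exact hg.comp_snd.mul (Measurable.aestronglyMeasurable (by fun_prop))
    · rw [one_mul, norm_mul, norm_mul]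
      exact mul_le_mul_of_nonneg_left (abs_max_sub_max_zero_le _ _) (norm_nonneg _)
  have e1 : ∀ u, ∫ z, g z * Real.log (max (Real.exp u) ‖z‖) =
      ∫ z, g z * (max (Real.log ‖z‖) u - max 0 u) := fun u => by
    have hi : Integrable fun z => g z * (max (Real.log ‖z‖) u - max 0 u) := by
      refine hgl.mono (hg.mul (Measurable.aestronglyMeasurable (by fun_prop)))
        (ae_of_all _ fun z => ?_)
      rw [norm_mul, norm_mul]
      exact mul_le_mul_of_nonneg_left (abs_max_sub_max_zero_le _ _) (norm_nonneg _)
    calc _ = ∫ z, (g z * (max (Real.log ‖z‖) u - max 0 u) + g z * max 0 u) := by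
          refine integral_congr_ae ?_
          filter_upwards [Measure.ae_ne volume (0 : ℂ)] with z hz
          have hz' : 0 < ‖z‖ := norm_pos_iff.2 hz
          have : Real.log (max (Real.exp u) ‖z‖) = max (Real.log ‖z‖) u := by
            rcases le_total (Real.exp u) ‖z‖ with h | h
            · rw [max_eq_right h, max_eq_left ((Real.le_log_iff_exp_le hz').2 h)]
            · rw [max_eq_left h, Real.log_exp, max_eq_right ((Real.log_le_iff_le_exp hz').2 h)]
          rw [this]; ring
      _ = _ := by rw [integral_add hi (hgi.mul_const _), integral_mul_const, hg0]; ring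
  have e2 : ∀ s, ∫ u, (max s u - max 0 u) ∂ν = I s - I 0 := fun s => by
    rcases le_total 0 s with h | h
    · exact integral_max_sub_max hν h
    · rw [← neg_sub, ← integral_max_sub_max hν h, ← integral_neg]
      simp
  have e3 : ∀ z, ∫ u, g z * (max (Real.log ‖z‖) u - max 0 u) ∂ν =
      g z * I (Real.log ‖z‖) - g z * I 0 := fun z => by
    rw [integral_const_mul, e2]; ring
  have h3 := hK.integral_prod_right
  simp only [e3] at h3
  have h4 : Integrable (fun z => g z * I (Real.log ‖z‖)) :=
    (h3.add (hgi.mul_const (I 0))).congr (ae_of_all _ fun z => by simp)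
  simp_rw [e1]
  refine ⟨hK.integral_prod_left, h4, ?_⟩
  rw [integral_integral_swap hK]
  simp_rw [e3]
  rw [integral_sub h4 (hgi.mul_const _), integral_mul_const, hg0]
  ring

/-- The single-zero estimate averaged over the circles of radius `exp u` and then over `ν`. It is
the counterpart, for the limit potential, of the estimate for the zeros of a polynomial. -/
theorem abs_integral_meanDefect_mul_sub_integral_radialMeasure_le {I : ℝ → ℝ}
    (hν : ∀ s t, I t - I s = ∫ v in s..t, ν.real (Set.Iio v))
    {φ : ℂ → ℝ} {R r ε : ℝ} (hr : 0 < r)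
    (hφ : Continuous φ) (hsupp : ∀ a, R ≤ ‖a‖ → φ a = 0)
    (hosc : ∀ a b, dist a b < r → |φ a - φ b| ≤ ε) :
    Integrable (fun z => meanDefect r φ z * I (Real.log ‖z‖)) ∧
    |(∫ z, meanDefect r φ z * I (Real.log ‖z‖)) -
      (∫ v, logDefect r v) * ∫ z, φ z ∂(radialMeasure ν)| ≤
      ε * (∫ v, logDefect r v) * ν.real Set.univ := by
  have hcs : HasCompactSupport φ := HasCompactSupport.intro (isCompact_closedBall (0 : ℂ) R)
    fun x hx => hsupp x (by simpa using (not_le.1 (by simpa using hx)).le)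
  obtain ⟨C, hC⟩ := hcs.exists_bound_of_continuous hφ
  have hg := (integrable_meanDefect hr.le hφ hsupp).aestronglyMeasurable
  have hgC := norm_meanDefect_le hr.le hC
  have hgs : ∀ z, R + r ≤ ‖z‖ → meanDefect r φ z = 0 := fun z hz =>
    meanDefect_eq_zero hr.le hsupp hz
  obtain ⟨h1, h2, h3⟩ := integral_integral_mul_log_max hν hg hgC hgs
    (integral_meanDefect hr.le hφ hsupp)
  obtain ⟨h4, h5⟩ := integrable_circleAverage_exp (ν := ν) hφ hC
  refine ⟨h2, ?_⟩
  have hc := integral_logDefect_pos hr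
  rw [← h3, h5, ← integral_const_mul, ← integral_sub h1 (h4.const_mul _), ← Real.norm_eq_abs]
  refine norm_integral_le_of_norm_le_const (ae_of_all _ fun u => ?_)
  rw [← circleAverage_integral_mul_log hg hgC hgs (Real.exp_pos u), ← integral_angleMeasure,
    ← integral_angleMeasure, ← integral_const_mul]
  have i1 : Integrable (fun θ => ∫ z, meanDefect r φ z *
      Real.log ‖z - circleMap 0 (Real.exp u) θ‖) angleMeasure :=
    (integrable_prod_mul_log_norm_sub hg hgC hgs (Real.exp u)).integral_prod_left
  have i2 : Integrable (fun θ => φ (circleMap 0 (Real.exp u) θ)) angleMeasure :=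
    Integrable.of_bound (by fun_prop) C (ae_of_all _ fun θ => hC _)
  rw [← integral_sub i1 (i2.const_mul _)]
  refine (norm_integral_le_of_norm_le_const (C := ε * ∫ v, logDefect r v)
    (ae_of_all _ fun θ => ?_)).trans (by simp)
  exact abs_integral_meanDefect_mul_log_sub_le hr hφ hsupp hosc _

end Radial

/-! ### The Legendre transform of `-log p` -/

section Legendre

variable {p : ℝ≥0 → ℝ≥0} {T₀ : ℝ≥0}

theorem mul_sub_negLog_of_pos {t : ℝ≥0} (ht : 0 < p t) (s : ℝ) :
    ((s * (t : ℝ) : ℝ) : EReal) - negLog p t = ((s * t + Real.log (p t) : ℝ) : EReal) := by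
  rw [negLog, sub_eq_add_neg, neg_neg, EReal.coe_add]
  congr 1
  rw [ENNReal.log_pos_real (by simpa using ht.ne') (by simp)]
  simp

theorem mul_sub_negLog_of_eq_zero {t : ℝ≥0} (ht : p t = 0) (s : ℝ) :
    ((s * (t : ℝ) : ℝ) : EReal) - negLog p t = ⊥ := by
  simp [negLog, ht]

theorem exists_bound_of_continuousOn_Icc (hp_zero : ∀ t, T₀ < t → p t = 0)
    (hp_cont : ContinuousOn p (Set.Icc 0 T₀)) : ∃ M : ℝ, 1 ≤ M ∧ ∀ t, (p t : ℝ) ≤ M := by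
  obtain ⟨M, hM⟩ := (isCompact_Icc.image_of_continuousOn hp_cont).bddAbove
  refine ⟨max 1 M, le_max_left _ _, fun t => ?_⟩
  rcases le_or_gt t T₀ with h | h
  · exact le_max_of_le_right (by exact_mod_cast hM ⟨t, ⟨zero_le, h⟩, rfl⟩)
  · rw [hp_zero t h]; simp

theorem exists_legendreFenchel_real (hT₀ : 0 < T₀)
    (hp_pos : ∀ t, t < T₀ → 0 < p t) (hp_zero : ∀ t, T₀ < t → p t = 0)
    (hp_cont : ContinuousOn p (Set.Icc 0 T₀)) :
    ∃ I : ℝ → ℝ, (∀ s, (I s : EReal) = legendreFenchel (negLog p) s) ∧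
      (∀ s t, 0 < p t → s * t + Real.log (p t) ≤ I s) ∧
      ∀ s ε, 0 < ε → ∃ t, t < T₀ ∧ I s - ε < s * t + Real.log (p t) := by
  obtain ⟨M, hM1, hM⟩ := exists_bound_of_continuousOn_Icc hp_zero hp_cont
  have hle : ∀ s t, 0 < p t →
      ((s * t + Real.log (p t) : ℝ) : EReal) ≤ legendreFenchel (negLog p) s := fun s t ht => by
    rw [← mul_sub_negLog_of_pos ht]
    exact le_iSup (fun t : ℝ≥0 => ((s * (t : ℝ) : ℝ) : EReal) - negLog p t) t
  have hge : ∀ s (B : ℝ), (∀ t, t < T₀ → s * t + Real.log (p t) ≤ B) →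
      legendreFenchel (negLog p) s ≤ B := fun s B hB => by
    refine iSup_le fun t => ?_
    rcases eq_or_ne (p t) 0 with h0 | h0
    · rw [mul_sub_negLog_of_eq_zero h0]; exact bot_le
    · have hpt : 0 < p t := pos_iff_ne_zero.2 h0
      rw [mul_sub_negLog_of_pos hpt, EReal.coe_le_coe_iff]
      have htT : t ≤ T₀ := by
        by_contra! h; exact h0 (hp_zero t h)
      rcases htT.lt_or_eq with h | rfl
      · exact hB t h
      -- The endpoint `T₀`, where `p` may be positive or zero, is a limit from the left, so the
      -- supremum over `t < T₀` already controls it.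
      · have hc : ContinuousWithinAt (fun x : ℝ≥0 => s * x + Real.log (p x)) (Set.Iio t) t := by
          have h1 : ContinuousWithinAt p (Set.Iio t) t :=
            (hp_cont t ⟨zero_le, le_rfl⟩).mono fun x hx => ⟨zero_le, le_of_lt hx⟩
          have h2 : ContinuousWithinAt (fun x => (p x : ℝ)) (Set.Iio t) t :=
            NNReal.continuous_coe.continuousAt.comp_continuousWithinAt h1
          exact (Continuous.continuousWithinAt (by fun_prop)).add (h2.log (by simpa using h0))
        have : (𝓝[<] t).NeBot := nhdsLT_neBot_of_exists_lt ⟨0, hT₀⟩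
        exact le_of_tendsto hc (eventually_mem_nhdsWithin.mono fun x hx => hB x hx)
  have hfin : ∀ s, ∃ x : ℝ, (x : EReal) = legendreFenchel (negLog p) s := fun s => by
    refine ⟨(legendreFenchel (negLog p) s).toReal, EReal.coe_toReal ?_ ?_⟩
    · refine ne_top_of_le_ne_top (EReal.coe_ne_top (|s| * T₀ + Real.log M)) (hge s _ fun t ht => ?_)
      have h1 : Real.log (p t) ≤ Real.log M := Real.log_le_log (by exact_mod_cast hp_pos t ht) (hM t)
      have h2 : s * t ≤ |s| * T₀ := mul_le_mul (le_abs_self s) (by exact_mod_cast ht.le)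
        t.coe_nonneg (abs_nonneg s)
      linarith
    · exact ne_bot_of_le_ne_bot (EReal.coe_ne_bot _) (hle s 0 (hp_pos 0 hT₀))
  choose I hI using hfin
  refine ⟨I, hI, fun s t ht => ?_, fun s ε hε => ?_⟩
  · rw [← EReal.coe_le_coe_iff, hI]; exact hle s t ht
  · by_contra! h
    have := hge s _ h
    rw [← hI, EReal.coe_le_coe_iff] at this
    linarith

end Legendre

/-- The real-valued function `I` is the Legendre–Fenchel transform of `-log p`, where `p` is
positive on `[0, T₀)` and vanishes beyond `T₀`. -/
structure IsLogTransform (p : ℝ≥0 → ℝ≥0) (T₀ : ℝ≥0) (I : ℝ → ℝ) : Prop where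
  pos : 0 < T₀
  p_pos : ∀ t, t < T₀ → 0 < p t
  p_zero : ∀ t, T₀ < t → p t = 0
  p_cont : ContinuousOn p (Set.Icc 0 T₀)
  le : ∀ s t, 0 < p t → s * t + Real.log (p t) ≤ I s
  exists_lt : ∀ s ε, 0 < ε → ∃ t, t < T₀ ∧ I s - ε < s * t + Real.log (p t)

namespace IsLogTransform

variable {p : ℝ≥0 → ℝ≥0} {T₀ : ℝ≥0} {I : ℝ → ℝ} (h : IsLogTransform p T₀ I)
include h

theorem monotone : Monotone I := by
  intro s t hst
  refine le_of_forall_pos_le_add fun ε hε => ?_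
  obtain ⟨x, hx, h1⟩ := h.exists_lt s ε hε
  have := h.le t x (h.p_pos x hx)
  have : s * x ≤ t * x := mul_le_mul_of_nonneg_right hst x.coe_nonneg
  linarith

theorem sub_le {s t : ℝ} (hst : s ≤ t) : I t - I s ≤ T₀ * (t - s) := by
  refine le_of_forall_pos_le_add fun ε hε => ?_
  obtain ⟨x, hx, h1⟩ := h.exists_lt t ε hε
  have := h.le s x (h.p_pos x hx)
  have hx' : (x : ℝ) ≤ T₀ := by exact_mod_cast hx.le
  have : x * (t - s) ≤ T₀ * (t - s) := mul_le_mul_of_nonneg_right hx' (by linarith)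
  linarith

theorem log_p_zero_le (s : ℝ) : Real.log (p 0) ≤ I s := by
  simpa using h.le s 0 (h.p_pos 0 h.pos)

theorem convexOn : ConvexOn ℝ Set.univ I := by
  refine ⟨convex_univ, fun s _ t _ a b ha hb hab => ?_⟩
  refine le_of_forall_pos_le_add fun ε hε => ?_
  obtain ⟨x, hx, h1⟩ := h.exists_lt (a • s + b • t) ε hε
  have h2 := mul_le_mul_of_nonneg_left (h.le s x (h.p_pos x hx)) ha
  have h3 := mul_le_mul_of_nonneg_left (h.le t x (h.p_pos x hx)) hb
  simp only [smul_eq_mul] at h1 ⊢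
  have : Real.log (p x) = a * Real.log (p x) + b * Real.log (p x) := by rw [← add_mul, hab, one_mul]
  linarith

theorem continuous : Continuous I :=
  continuousOn_univ.1 (h.convexOn.continuousOn isOpen_univ)

/-- For very negative `s` near-maximisers sit close to `0`: when `t ≥ d`, the term `s * d` outweighs
the upper bound `log M`. This is what makes `z ↦ I (log ‖z‖)` extend continuously across the origin.
-/
theorem tendsto_atBot : Tendsto I atBot (𝓝 (Real.log (p 0))) := by
  obtain ⟨M, hM1, hM⟩ := exists_bound_of_continuousOn_Icc h.p_zero h.p_cont
  refine Metric.tendsto_nhds.2 fun ε hε => ?_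
  have hp0 : 0 < p 0 := h.p_pos 0 h.pos
  have hc : ContinuousWithinAt (fun x => Real.log (p x)) (Set.Icc 0 T₀) 0 :=
    ContinuousWithinAt.log (NNReal.continuous_coe.continuousAt.comp_continuousWithinAt
      (h.p_cont 0 ⟨le_rfl, zero_le⟩)) (by simpa using hp0.ne')
  obtain ⟨d, hd, hd'⟩ := Metric.continuousWithinAt_iff.1 hc (ε / 4) (by positivity)
  filter_upwards [eventually_le_atBot (min 0 ((Real.log (p 0) - Real.log M) / d))] with s hs
  have hs0 : s ≤ 0 := hs.trans (min_le_left _ _)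
  have hsd : s * d ≤ Real.log (p 0) - Real.log M := by
    rw [← le_div_iff₀ hd]; exact hs.trans (min_le_right _ _)
  obtain ⟨t, ht, h1⟩ := h.exists_lt s (ε / 4) (by positivity)
  rw [Real.dist_eq, abs_lt]
  refine ⟨by linarith [h.log_p_zero_le s], ?_⟩
  rcases lt_or_ge (t : ℝ) d with htd | htd
  · have := hd' ⟨zero_le, ht.le⟩ (by simpa [NNReal.dist_eq] using htd)
    rw [Real.dist_eq, abs_lt] at this
    have : s * t ≤ 0 := mul_nonpos_of_nonpos_of_nonneg hs0 t.coe_nonneg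
    linarith
  · have h2 : Real.log (p t) ≤ Real.log M :=
      Real.log_le_log (by exact_mod_cast h.p_pos t ht) (hM t)
    have : s * t ≤ s * d := mul_le_mul_of_nonpos_left htd hs0
    linarith

end IsLogTransform

open Classical in
/-- The radial function `z ↦ I (log ‖z‖)`, with the value `ℓ` at the origin. -/
noncomputable def radialExtension (I : ℝ → ℝ) (ℓ : ℝ) (z : ℂ) : ℝ :=
  if z = 0 then ℓ else I (Real.log ‖z‖)

theorem IsLogTransform.continuous_radialExtension {p : ℝ≥0 → ℝ≥0} {T₀ : ℝ≥0} {I : ℝ → ℝ}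
    (h : IsLogTransform p T₀ I) : Continuous (radialExtension I (Real.log (p 0))) := by
  rw [continuous_iff_continuousAt]
  intro z
  rcases eq_or_ne z 0 with rfl | hz
  · rw [continuousAt_iff_punctured_nhds]
    have h1 : Tendsto (fun z : ℂ => I (Real.log ‖z‖)) (𝓝[≠] 0) (𝓝 (Real.log (p 0))) := by
      refine h.tendsto_atBot.comp (Real.tendsto_log_nhdsGT_zero.comp ?_)
      exact tendsto_norm_nhdsNE_zero
    rw [radialExtension, if_pos rfl]
    refine h1.congr' ?_
    filter_upwards [self_mem_nhdsWithin] with z hz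
    rw [radialExtension, if_neg (by simpa using hz)]
  · have h1 : ContinuousAt (fun z : ℂ => I (Real.log ‖z‖)) z :=
      h.continuous.continuousAt.comp (continuous_norm.continuousAt.log (by simpa using hz))
    refine h1.congr ?_
    filter_upwards [isOpen_ne.mem_nhds hz] with w hw
    rw [radialExtension, if_neg hw]

/-! ### Anticoncentration, Vandermonde inversion and tails -/

/-- The support contains two points at distance `5 * ρ`. A disc of radius `ρ` cannot meet the
`ρ`-discs around both, so it misses a set of definite mass. -/
theorem exists_closedBall_le_of_nondegenerate (ν : Measure ℂ) [IsProbabilityMeasure ν]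
    (hν : ¬ ∃ a : ℂ, ∀ᵐ z ∂ν, z = a) :
    ∃ ρ : ℝ, 0 < ρ ∧ ∃ q : ℝ≥0∞, q < 1 ∧ ∀ x, ν (Metric.closedBall x ρ) ≤ q := by
  have hsupp : ν.support ∈ ae ν := Measure.support_mem_ae
  obtain ⟨a, ha⟩ : ν.support.Nonempty := Measure.nonempty_support (IsProbabilityMeasure.ne_zero ν)
  obtain ⟨b, hb, hab⟩ : ∃ b ∈ ν.support, b ≠ a := by
    by_contra! h
    exact hν ⟨a, by filter_upwards [hsupp] with z hz using h z hz⟩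
  set ρ := dist b a / 5 with hρ
  have hd : 0 < dist b a := dist_pos.2 hab
  have hρ0 : 0 < ρ := by positivity
  have hA := (Measure.mem_support_iff_forall a).1 ha _ (Metric.ball_mem_nhds a hρ0)
  have hB := (Measure.mem_support_iff_forall b).1 hb _ (Metric.ball_mem_nhds b hρ0)
  refine ⟨ρ, hρ0, 1 - min (ν (Metric.ball a ρ)) (ν (Metric.ball b ρ)),
    ENNReal.sub_lt_self ENNReal.one_ne_top one_ne_zero (lt_min hA hB).ne', fun x => ?_⟩
  have key : ∀ y, Disjoint (Metric.closedBall x ρ) (Metric.ball y ρ) →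
      ν (Metric.closedBall x ρ) ≤ 1 - ν (Metric.ball y ρ) := fun y hy => by
    rw [← prob_compl_eq_one_sub Metric.isOpen_ball.measurableSet]
    exact measure_mono hy.subset_compl_right
  by_cases h : Disjoint (Metric.closedBall x ρ) (Metric.ball a ρ)
  · exact (key a h).trans (tsub_le_tsub_left (min_le_left _ _) _)
  · refine (key b ?_).trans (tsub_le_tsub_left (min_le_right _ _) _)
    obtain ⟨y, hy1, hy2⟩ := Set.not_disjoint_iff.1 h
    refine Set.disjoint_left.2 fun w hw1 hw2 => ?_
    rw [Metric.mem_closedBall] at hy1 hw1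
    rw [Metric.mem_ball] at hy2 hw2
    have h1 := dist_triangle b w a
    have h2 := dist_triangle w x a
    have h3 := dist_triangle x y a
    rw [dist_comm b w] at h1
    rw [dist_comm x y] at h3
    linarith

theorem measure_mem_le_of_indepFun {Ω E E' : Type*} [MeasurableSpace Ω] [MeasurableSpace E]
    [MeasurableSpace E'] {P : Measure Ω} [IsProbabilityMeasure P] {X : Ω → E} {Y : Ω → E'}
    (hX : Measurable X) (hY : Measurable Y) (hXY : IndepFun X Y P) {S : Set (E × E')}
    (hS : MeasurableSet S) {c : ℝ≥0∞} (hc : ∀ y, P {ω | (X ω, y) ∈ S} ≤ c) :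
    P {ω | (X ω, Y ω) ∈ S} ≤ c := by
  have h := (indepFun_iff_map_prod_eq_prod_map_map hX.aemeasurable hY.aemeasurable).1 hXY
  have := Measure.isProbabilityMeasure_map hX.aemeasurable (μ := P)
  have := Measure.isProbabilityMeasure_map hY.aemeasurable (μ := P)
  have e : P {ω | (X ω, Y ω) ∈ S} = P.map (fun ω => (X ω, Y ω)) S :=
    (Measure.map_apply (hX.prodMk hY) hS).symm
  rw [e, h, Measure.prod_apply_symm hS]
  calc _ ≤ ∫⁻ y, c ∂(P.map Y) := by
        refine lintegral_mono fun y => ?_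
        rw [Measure.map_apply hX (measurable_prodMk_right hS)]
        exact hc y
    _ = c := by simp

/-- If two sequences in `B` that differ only on the finite set `T` are within distance `ρ` of each
other, then an independent sequence lies in `B` with probability at most `q ^ #T`, where `q` bounds
the mass of balls of radius `ρ`. -/
theorem measure_mem_le_pow_of_sections {Ω : Type*} [MeasurableSpace Ω] {P : Measure Ω}
    [IsProbabilityMeasure P] {ξ : ℕ → Ω → ℂ} (hm : ∀ k, Measurable (ξ k)) (hind : iIndepFun ξ P)
    {ρ : ℝ} {q : ℝ≥0∞} (hq : ∀ k x, P {ω | ξ k ω ∈ Metric.closedBall x ρ} ≤ q)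
    {B : Set (ℕ → ℂ)} (hB : MeasurableSet B) {N : ℕ}
    (hN : ∀ x x' : ℕ → ℂ, (∀ k < N, x k = x' k) → x ∈ B → x' ∈ B)
    {T : Finset ℕ}
    (hsec : ∀ x ∈ B, ∀ x' ∈ B, (∀ k ∉ T, x k = x' k) → ∀ k ∈ T, dist (x k) (x' k) ≤ ρ) :
    P {ω | (fun k => ξ k ω) ∈ B} ≤ q ^ T.card := by
  classical
  set T' := Finset.range N \ T with hT'
  have hdisj : Disjoint T T' := Finset.disjoint_sdiff
  set X : Ω → T → ℂ := fun ω k => ξ k ω with hX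
  set Y : Ω → T' → ℂ := fun ω k => ξ k ω with hY
  have hXY : IndepFun X Y P := iIndepFun.indepFun_finset T T' hdisj hind hm
  -- Indices from `N` on do not affect membership in `B`, so those outside `T` are filled with `0`.
  set glue : (T → ℂ) × (T' → ℂ) → ℕ → ℂ := fun p k =>
    if h : k ∈ T then p.1 ⟨k, h⟩ else if h' : k ∈ T' then p.2 ⟨k, h'⟩ else 0 with hglue
  have hgm : Measurable glue := by
    refine measurable_pi_lambda _ fun k => ?_
    simp only [hglue]
    split_ifs <;> fun_prop
  have hle : P {ω | (X ω, Y ω) ∈ glue ⁻¹' B} ≤ q ^ T.card := by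
    refine measure_mem_le_of_indepFun (by fun_prop) (by fun_prop) hXY (hgm hB) fun y => ?_
    by_cases hne : ∃ x, glue (x, y) ∈ B
    -- With the coordinates off `T` frozen, one member of the section serves as centre: every other
    -- member lies in the polydisc of radius `ρ` around it.
    · obtain ⟨x₀, hx₀⟩ := hne
      set c : ℕ → ℂ := glue (x₀, y)
      calc P {ω | (X ω, y) ∈ glue ⁻¹' B}
          ≤ P (⋂ k ∈ T, ξ k ⁻¹' Metric.closedBall (c k) ρ) := by
            refine measure_mono fun ω hω => ?_
            simp only [Set.mem_iInter]
            intro k hk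
            have := hsec _ hω _ hx₀ (fun k hk => by simp [hglue, hk, c]) k hk
            simpa [hglue, hk, hX, c] using this
        _ = ∏ k ∈ T, P (ξ k ⁻¹' Metric.closedBall (c k) ρ) :=
            hind.measure_inter_preimage_eq_mul T fun k _ => Metric.isClosed_closedBall.measurableSet
        _ ≤ ∏ k ∈ T, q := Finset.prod_le_prod' fun k _ => hq k _
        _ = q ^ T.card := by simp
    · push Not at hne
      have : {ω | (X ω, y) ∈ glue ⁻¹' B} = ∅ := by
        ext ω; simpa using hne (X ω)
      rw [this]; simp
  refine (measure_mono fun ω hω => ?_).trans hle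
  refine hN _ _ (fun k hk => ?_) hω
  simp only [hglue]
  split_ifs with h1 h2
  · rfl
  · rfl
  · exact absurd (Finset.mem_sdiff.2 ⟨Finset.mem_range.2 hk, h1⟩) h2

/-- The Vandermonde matrix of distinct nodes has a bounded inverse; the constant depends on the
nodes alone. -/
theorem exists_coeff_bound_of_injective {m : ℕ} {z : Fin m → ℂ} (hz : Function.Injective z) :
    ∃ C : ℝ, 0 < C ∧ ∀ (y : Fin m → ℂ) (r : ℝ), 0 ≤ r →
      (∀ i, ‖∑ j, y j * z i ^ (j : ℕ)‖ ≤ r) → ∀ j, ‖y j‖ ≤ C * r := by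
  set V := Matrix.vandermonde z
  have hV : IsUnit V := by
    rw [Matrix.isUnit_iff_isUnit_det, isUnit_iff_ne_zero]
    exact Matrix.det_vandermonde_ne_zero_iff.2 hz
  have hinj : (V.mulVecLin).ker = ⊥ := by
    rw [LinearMap.ker_eq_bot]
    exact Matrix.mulVec_injective_iff_isUnit.2 hV
  obtain ⟨K, hK0, hK⟩ := V.mulVecLin.exists_antilipschitzWith hinj
  refine ⟨K, by exact_mod_cast hK0, fun y r hr h j => ?_⟩
  have h1 := hK.le_mul_dist y 0
  rw [map_zero, dist_zero_right, dist_zero_right] at h1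
  refine (norm_le_pi_norm y j).trans (h1.trans (mul_le_mul_of_nonneg_left ?_ K.coe_nonneg))
  refine (pi_norm_le_iff_of_nonneg hr).2 fun i => ?_
  have := h i
  simpa [V, Matrix.mulVec, dotProduct, Matrix.vandermonde_apply, mul_comm] using this

/-- The union bound costs a factor of order `L n`, and plain Markov would leave only boundedness.
Keeping the integral restricted to the event `A n`, whose probability vanishes, gives `L n * P (A n)
→ 0` by absolute continuity of the integral. -/
theorem tendsto_measure_exists_exp_lt {Ω : Type*} [MeasurableSpace Ω] {P : Measure Ω}
    [IsProbabilityMeasure P] {ξ : ℕ → Ω → ℂ} (hm : ∀ k, Measurable (ξ k))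
    (hident : ∀ k, IdentDistrib (ξ k) (ξ 0) P P)
    (hlog : Integrable (fun ω => Real.log (1 + ‖ξ 0 ω‖)) P)
    {L D : ℕ → ℕ} (hL : Tendsto L atTop atTop) {K : ℕ} (hD : ∀ n, D n + 1 ≤ K * L n)
    {ε : ℝ} (hε : 0 < ε) :
    Tendsto (fun n => P {ω | ∃ k ≤ D n, Real.exp (ε * L n) < ‖ξ k ω‖}) atTop (𝓝 0) := by
  set X : Ω → ℝ := fun ω => Real.log (1 + ‖ξ 0 ω‖) with hX
  set A : ℕ → Set Ω := fun n => {ω | ENNReal.ofReal (ε * L n) ≤ ENNReal.ofReal (X ω)} with hA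
  have hXm : Measurable X := by
    have := hm 0
    fun_prop
  have hfin : ∫⁻ ω, ENNReal.ofReal (X ω) ∂P ≠ ∞ := hlog.lintegral_lt_top.ne
  have hLr : Tendsto (fun n => ε * (L n : ℝ)) atTop atTop :=
    (tendsto_natCast_atTop_atTop.comp hL).const_mul_atTop hε
  have hA0 : Tendsto (P ∘ A) atTop (𝓝 0) := by
    have h1 : Tendsto (fun n => (∫⁻ ω, ENNReal.ofReal (X ω) ∂P) / ENNReal.ofReal (ε * L n)) atTop
        (𝓝 0) := by
      have := ENNReal.Tendsto.const_div (a := ∫⁻ ω, ENNReal.ofReal (X ω) ∂P)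
        (ENNReal.tendsto_ofReal_atTop.comp hLr) (Or.inr hfin)
      simpa using this
    refine tendsto_of_tendsto_of_tendsto_of_le_of_le' tendsto_const_nhds h1
      (Eventually.of_forall fun _ => zero_le) ?_
    filter_upwards [hLr.eventually_gt_atTop 0] with n hn
    exact meas_ge_le_lintegral_div hXm.ennreal_ofReal.aemeasurable
      (ENNReal.ofReal_pos.2 hn).ne' ENNReal.ofReal_ne_top
  have h2 := tendsto_setLIntegral_zero hfin hA0
  have h3 : Tendsto (fun n => (K : ℝ≥0∞) * (ENNReal.ofReal ε)⁻¹ *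
      ∫⁻ ω in A n, ENNReal.ofReal (X ω) ∂P) atTop (𝓝 0) := by
    have := ENNReal.Tendsto.const_mul (a := (K : ℝ≥0∞) * (ENNReal.ofReal ε)⁻¹) h2
      (Or.inr (ENNReal.mul_ne_top (by simp) (ENNReal.inv_ne_top.2 (ENNReal.ofReal_pos.2 hε).ne')))
    simpa using this
  refine tendsto_of_tendsto_of_tendsto_of_le_of_le tendsto_const_nhds h3 (fun _ => zero_le) fun n => ?_
  have hε0 : ENNReal.ofReal ε ≠ 0 := (ENNReal.ofReal_pos.2 hε).ne'
  calc P {ω | ∃ k ≤ D n, Real.exp (ε * L n) < ‖ξ k ω‖}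
      ≤ P (⋃ k ∈ Finset.range (D n + 1), ξ k ⁻¹' {z | Real.exp (ε * L n) < ‖z‖}) := by
        refine measure_mono ?_
        rintro ω ⟨k, hk, hω⟩
        simp only [Set.mem_iUnion]
        exact ⟨k, Finset.mem_range.2 (by omega), hω⟩
    _ ≤ ∑ k ∈ Finset.range (D n + 1), P (ξ k ⁻¹' {z | Real.exp (ε * L n) < ‖z‖}) :=
        measure_biUnion_finset_le _ _
    _ ≤ ∑ k ∈ Finset.range (D n + 1), P (A n) := by
        refine Finset.sum_le_sum fun k _ => ?_
        rw [(hident k).measure_mem_eq (isOpen_lt continuous_const continuous_norm).measurableSet]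
        refine measure_mono fun ω hω => ENNReal.ofReal_le_ofReal ?_
        have hω : Real.exp (ε * L n) < ‖ξ 0 ω‖ := hω
        rw [hX, Real.le_log_iff_exp_le (by positivity)]
        linarith
    _ = ((D n + 1 : ℕ) : ℝ≥0∞) * P (A n) := by simp
    _ ≤ ((K * L n : ℕ) : ℝ≥0∞) * P (A n) := by gcongr; exact hD n
    _ = K * (ENNReal.ofReal ε)⁻¹ * (ENNReal.ofReal (ε * L n) * P (A n)) := by
        rw [ENNReal.ofReal_mul hε.le, ENNReal.ofReal_natCast, Nat.cast_mul]
        rw [show (K : ℝ≥0∞) * (ENNReal.ofReal ε)⁻¹ * (ENNReal.ofReal ε * L n * P (A n)) =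
          K * ((ENNReal.ofReal ε)⁻¹ * ENNReal.ofReal ε) * L n * P (A n) by ring,
          ENNReal.inv_mul_cancel hε0 ENNReal.ofReal_ne_top, mul_one]
    _ ≤ K * (ENNReal.ofReal ε)⁻¹ * ∫⁻ ω in A n, ENNReal.ofReal (X ω) ∂P := by
        gcongr
        calc _ = ∫⁻ ω in A n, ENNReal.ofReal (ε * L n) ∂P := by simp
          _ ≤ _ := setLIntegral_mono hXm.ennreal_ofReal fun ω hω => hω

/-! ### Exponential size of the monomials -/

/-- The assumptions on the degrees `D n` and the coefficients `c k n`: `D n ∼ T₀ L n`, and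
`|c k n| ^ (1 / L n)` is uniformly close to `p (k / L n)`. -/
structure CoeffAsymptotics (p : ℝ≥0 → ℝ≥0) (T₀ : ℝ≥0) (L D : ℕ → ℕ) (c : ℕ → ℕ → ℂ) : Prop where
  L_pos : ∀ n, 0 < L n
  tendsto_L : Tendsto L atTop atTop
  ratio : Tendsto (fun n => (D n : ℝ) / L n) atTop (𝓝 T₀)
  approx : ∀ ε > 0, ∀ᶠ n in atTop, ∀ k ≤ D n,
    |‖c k n‖ ^ (1 / (L n : ℝ)) - (p (min ((k : ℝ≥0) / (L n : ℝ≥0)) T₀) : ℝ)| ≤ ε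

namespace CoeffAsymptotics

variable {p : ℝ≥0 → ℝ≥0} {T₀ : ℝ≥0} {L D : ℕ → ℕ} {c : ℕ → ℕ → ℂ} {I : ℝ → ℝ}

theorem tendsto_L_real (h : CoeffAsymptotics p T₀ L D c) :
    Tendsto (fun n => (L n : ℝ)) atTop atTop :=
  tendsto_natCast_atTop_atTop.comp h.tendsto_L

theorem norm_eq_pow (h : CoeffAsymptotics p T₀ L D c) (k n : ℕ) :
    ‖c k n‖ = (‖c k n‖ ^ (1 / (L n : ℝ))) ^ L n := by
  rw [one_div, Real.rpow_inv_natCast_pow (norm_nonneg _) (h.L_pos n).ne']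

/-- The hypothesis on the coefficients has an additive error, the conclusion a multiplicative one.
The conversion is uniform in `z`, even near `0`, because `exp (I s) ≥ p 0 > 0`. -/
theorem eventually_norm_mul_pow_le (h : CoeffAsymptotics p T₀ L D c) (hI : IsLogTransform p T₀ I)
    {ε R : ℝ} (hε : 0 < ε) (hR : 1 ≤ R) :
    ∀ᶠ n in atTop, ∀ k ≤ D n, ∀ z : ℂ, z ≠ 0 → ‖z‖ ≤ R →
      ‖c k n‖ * ‖z‖ ^ k ≤ Real.exp (L n * (I (Real.log ‖z‖) + ε)) := by
  have hp0 : 0 < (p 0 : ℝ) := by exact_mod_cast hI.p_pos 0 hI.pos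
  have hlR : 0 ≤ Real.log R := Real.log_nonneg hR
  -- The first summand pays for the additive error in `p`, the second for `k / L n` exceeding `T₀`
  -- by up to `κ`; the total loss `κ * A` is `ε`.
  set A := Real.exp (T₀ * Real.log R) / p 0 + Real.log R with hA
  have hA0 : 0 < A := by positivity
  set κ := ε / A with hκ
  have hκ0 : 0 < κ := by positivity
  filter_upwards [h.approx κ hκ0, h.ratio.eventually_le_const (show (T₀ : ℝ) < T₀ + κ by linarith)]
    with n hn hratio k hk z hz hzR
  have hLn : (0 : ℝ) < L n := by exact_mod_cast h.L_pos n
  have hz0 : 0 < ‖z‖ := norm_pos_iff.2 hz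
  set s := Real.log ‖z‖ with hs
  have hsR : s ≤ Real.log R := Real.log_le_log hz0 hzR
  set t : ℝ≥0 := min ((k : ℝ≥0) / (L n : ℝ≥0)) T₀ with ht
  have htT : (t : ℝ) ≤ T₀ := by exact_mod_cast min_le_right _ _
  have htk : (t : ℝ) ≤ k / L n := by
    have : t ≤ (k : ℝ≥0) / (L n : ℝ≥0) := min_le_left _ _
    exact_mod_cast this
  have hkt : (k : ℝ) / L n ≤ t + κ := by
    have h1 : (k : ℝ) / L n ≤ T₀ + κ := by
      refine le_trans ?_ hratio
      gcongr
    have h2 : (t : ℝ) = min ((k : ℝ) / L n) T₀ := by rw [ht]; push_cast; rfl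
    rw [h2]
    rcases min_cases ((k : ℝ) / L n) T₀ with h3 | h3 <;> rw [h3.1] <;> linarith
  have hpow : ‖z‖ ^ k ≤ Real.exp (t * s + κ * Real.log R) ^ L n := by
    rw [← Real.exp_log hz0, ← Real.exp_nat_mul, ← Real.exp_nat_mul, Real.exp_le_exp, ← hs]
    have : (k : ℝ) * s = L n * (k / L n * s) := by field_simp
    rw [this]
    refine mul_le_mul_of_nonneg_left ?_ hLn.le
    have : (k / L n - t) * s ≤ κ * Real.log R :=
      (mul_le_mul_of_nonneg_left hsR (by linarith)).trans
        (mul_le_mul_of_nonneg_right (by linarith) hlR)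
    linarith
  have hc := hn k hk
  rw [← ht] at hc
  have hc' : ‖c k n‖ ^ (1 / (L n : ℝ)) ≤ p t + κ := by linarith [le_abs_self (‖c k n‖ ^ (1 / (L n : ℝ)) - p t)]
  have hb : ‖c k n‖ ^ (1 / (L n : ℝ)) * Real.exp (t * s + κ * Real.log R) ≤
      Real.exp (I s + ε) := by
    have h1 : (p t : ℝ) * Real.exp (t * s) ≤ Real.exp (I s) := by
      rcases eq_or_ne (p t) 0 with h0 | h0
      · rw [h0]; simp [Real.exp_nonneg]
      · have hpt : 0 < (p t : ℝ) := by exact_mod_cast pos_iff_ne_zero.2 h0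
        have := hI.le s t (pos_iff_ne_zero.2 h0)
        calc (p t : ℝ) * Real.exp (t * s) = Real.exp (s * t + Real.log (p t)) := by
              rw [Real.exp_add, Real.exp_log hpt]; ring_nf
          _ ≤ _ := Real.exp_le_exp.2 this
    have h2 : Real.exp (t * s) ≤ Real.exp (I s) * (Real.exp (T₀ * Real.log R) / p 0) := by
      have h3 : (p 0 : ℝ) ≤ Real.exp (I s) := by
        rw [← Real.log_le_iff_le_exp hp0]; exact hI.log_p_zero_le s
      have h4 : (t : ℝ) * s ≤ T₀ * Real.log R :=
        (mul_le_mul_of_nonneg_left hsR t.coe_nonneg).trans (mul_le_mul_of_nonneg_right htT hlR)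
      rw [mul_div_assoc', le_div_iff₀ hp0, mul_comm]
      exact mul_le_mul h3 (Real.exp_le_exp.2 h4) (Real.exp_nonneg _) (Real.exp_nonneg _)
    calc _ ≤ (p t + κ) * Real.exp (t * s + κ * Real.log R) :=
          mul_le_mul_of_nonneg_right hc' (Real.exp_nonneg _)
      _ = (p t * Real.exp (t * s) + κ * Real.exp (t * s)) * Real.exp (κ * Real.log R) := by
          rw [Real.exp_add]; ring
      _ ≤ (Real.exp (I s) + κ * (Real.exp (I s) * (Real.exp (T₀ * Real.log R) / p 0))) *
          Real.exp (κ * Real.log R) := by gcongr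
      _ = Real.exp (I s) * (κ * (Real.exp (T₀ * Real.log R) / p 0) + 1) *
          Real.exp (κ * Real.log R) := by ring
      _ ≤ Real.exp (I s) * Real.exp (κ * (Real.exp (T₀ * Real.log R) / p 0)) *
          Real.exp (κ * Real.log R) := by gcongr; exact Real.add_one_le_exp _
      _ = Real.exp (I s + κ * A) := by rw [← Real.exp_add, ← Real.exp_add, hA]; ring_nf
      _ = _ := by rw [hκ, div_mul_cancel₀ _ hA0.ne']
  calc ‖c k n‖ * ‖z‖ ^ k ≤ (‖c k n‖ ^ (1 / (L n : ℝ))) ^ L n *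
        Real.exp (t * s + κ * Real.log R) ^ L n := by
        rw [← h.norm_eq_pow]
        exact mul_le_mul_of_nonneg_left hpow (norm_nonneg _)
    _ = (‖c k n‖ ^ (1 / (L n : ℝ)) * Real.exp (t * s + κ * Real.log R)) ^ L n := by rw [mul_pow]
    _ ≤ Real.exp (I s + ε) ^ L n := by gcongr
    _ = _ := by rw [← Real.exp_nat_mul]

theorem eventually_degree_le_exp (h : CoeffAsymptotics p T₀ L D c) {ε : ℝ} (hε : 0 < ε) :
    ∀ᶠ n in atTop, (D n : ℝ) + 1 ≤ Real.exp (ε * L n) := by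
  have h1 : Tendsto (fun n => Real.exp (ε * L n) / (L n : ℝ)) atTop atTop := by
    simpa [Function.comp_def] using
      (tendsto_exp_mul_div_rpow_atTop 1 ε hε).comp h.tendsto_L_real
  filter_upwards [h.ratio.eventually_le_const (show (T₀ : ℝ) < T₀ + 1 by linarith),
    h1.eventually_ge_atTop (T₀ + 2)] with n hn1 hn2
  have hLn : (1 : ℝ) ≤ L n := by exact_mod_cast h.L_pos n
  rw [div_le_iff₀ (by linarith)] at hn1
  rw [le_div_iff₀ (by linarith)] at hn2
  linarith

theorem eventually_norm_sum_le (h : CoeffAsymptotics p T₀ L D c) (hI : IsLogTransform p T₀ I)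
    {ε R : ℝ} (hε : 0 < ε) (hR : 1 ≤ R) :
    ∀ᶠ n in atTop, ∀ x : ℕ → ℂ, (∀ k ≤ D n, ‖x k‖ ≤ Real.exp (ε / 3 * L n)) →
      ∀ z : ℂ, z ≠ 0 → ‖z‖ ≤ R →
      ‖∑ k ∈ Finset.range (D n + 1), x k * c k n * z ^ k‖ ≤
        Real.exp (L n * (I (Real.log ‖z‖) + ε)) := by
  -- Three losses of `ε / 3`: the random variables, the monomials and the number of terms.
  filter_upwards [h.eventually_norm_mul_pow_le hI (ε := ε / 3) (by positivity) hR,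
    h.eventually_degree_le_exp (ε := ε / 3) (by positivity)] with n hn1 hn2 x hx z hz hzR
  calc ‖∑ k ∈ Finset.range (D n + 1), x k * c k n * z ^ k‖
      ≤ ∑ k ∈ Finset.range (D n + 1), Real.exp (ε / 3 * L n) *
          Real.exp (L n * (I (Real.log ‖z‖) + ε / 3)) := by
        refine norm_sum_le_of_le _ fun k hk => ?_
        have hk : k ≤ D n := by rw [Finset.mem_range] at hk; omega
        rw [norm_mul, norm_mul, norm_pow, mul_assoc]
        exact mul_le_mul (hx k hk) (hn1 k hk z hz hzR) (by positivity) (by positivity)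
    _ = ((D n : ℝ) + 1) * (Real.exp (ε / 3 * L n) *
          Real.exp (L n * (I (Real.log ‖z‖) + ε / 3))) := by simp
    _ ≤ Real.exp (ε / 3 * L n) * (Real.exp (ε / 3 * L n) *
          Real.exp (L n * (I (Real.log ‖z‖) + ε / 3))) := by gcongr
    _ = _ := by rw [← Real.exp_add, ← Real.exp_add]; ring_nf

/-- There are arbitrarily long blocks of indices whose monomials nearly attain the exponential
growth rate `I (log |a|)`. -/
theorem eventually_exists_window (h : CoeffAsymptotics p T₀ L D c) (hI : IsLogTransform p T₀ I)
    {a : ℂ} (ha : a ≠ 0) {ε : ℝ} (hε : 0 < ε) (m : ℕ) :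
    ∀ᶠ n in atTop, ∃ k₀, k₀ + m ≤ D n + 1 ∧ ∀ k, k₀ ≤ k → k < k₀ + m →
      Real.exp (L n * (I (Real.log ‖a‖) - ε)) ≤ ‖c k n‖ * ‖a‖ ^ k := by
  have ha0 : 0 < ‖a‖ := norm_pos_iff.2 ha
  set s := Real.log ‖a‖ with hs
  obtain ⟨t₀, ht₀, hlt⟩ := hI.exists_lt s (ε / 2) (by positivity)
  have hpt₀ : 0 < p t₀ := hI.p_pos t₀ ht₀
  -- By continuity at the interior point `t₀`, near-maximality persists on an interval. The indices
  -- with `k / L n` in it number about `d * L n`, eventually at least `m`.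
  obtain ⟨d, hd, hdT, hd'⟩ : ∃ d : ℝ, 0 < d ∧ t₀ + d < T₀ ∧ ∀ t : ℝ≥0, t₀ ≤ t → (t : ℝ) ≤ t₀ + d →
      I s - ε / 2 < s * t + Real.log (p t) := by
    have hnhds : Set.Icc 0 T₀ ∈ 𝓝 t₀ := by
      refine mem_of_superset (Iio_mem_nhds ht₀) fun t ht => ⟨zero_le, le_of_lt ht⟩
    have hc : ContinuousAt (fun t : ℝ≥0 => s * t + Real.log (p t)) t₀ := by
      have h1 : ContinuousAt (fun x => (p x : ℝ)) t₀ :=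
        NNReal.continuous_coe.continuousAt.comp (hI.p_cont.continuousAt hnhds)
      exact (Continuous.continuousAt (by fun_prop)).add (h1.log (by simpa using hpt₀.ne'))
    obtain ⟨d, hd, hball⟩ := Metric.eventually_nhds_iff.1 (hc.eventually_const_lt hlt)
    have hT : 0 < (T₀ : ℝ) - t₀ := sub_pos.2 (by exact_mod_cast ht₀)
    refine ⟨min (d / 2) ((T₀ - t₀) / 2), by positivity, ?_, fun t h1 h2 => hball ?_⟩
    · linarith [min_le_right (d / 2) (((T₀ : ℝ) - t₀) / 2)]
    · have h1' : (t₀ : ℝ) ≤ t := by exact_mod_cast h1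
      rw [NNReal.dist_eq, abs_of_nonneg (by linarith)]
      linarith [min_le_left (d / 2) (((T₀ : ℝ) - t₀) / 2)]
  -- A lower bound for `p` on that interval. An additive error of `(1 - exp (-(ε / 2))) * b` then
  -- costs at most the factor `exp (-(ε / 2))`.
  set b := Real.exp (I s - ε / 2 - |s| * T₀) with hb
  have hex : Real.exp (-(ε / 2)) < 1 := by rw [Real.exp_lt_one_iff]; linarith
  have hκ : 0 < (1 - Real.exp (-(ε / 2))) * b := mul_pos (by linarith) (Real.exp_pos _)
  filter_upwards [h.approx _ hκ, h.ratio.eventually_const_lt hdT,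
    h.tendsto_L_real.eventually_ge_atTop ((m + 1) / d)] with n hn hratio hL
  have hLn : (0 : ℝ) < L n := by exact_mod_cast h.L_pos n
  rw [div_le_iff₀ hd] at hL
  rw [lt_div_iff₀ hLn] at hratio
  have hceil := Nat.ceil_lt_add_one (show 0 ≤ (t₀ : ℝ) * L n by positivity)
  refine ⟨⌈(t₀ : ℝ) * L n⌉₊, ?_, fun k hk1 hk2 => ?_⟩
  · have : ((⌈(t₀ : ℝ) * L n⌉₊ + m : ℕ) : ℝ) ≤ (D n + 1 : ℕ) := by push_cast; nlinarith
    exact_mod_cast this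
  have hk1' : (t₀ : ℝ) * L n ≤ k := (Nat.le_ceil _).trans (by exact_mod_cast hk1)
  have hk2' : (k : ℝ) ≤ (t₀ + d) * L n := by
    have : (k : ℝ) < ⌈(t₀ : ℝ) * L n⌉₊ + m := by exact_mod_cast hk2
    nlinarith
  have hkD : k ≤ D n := by
    have : (k : ℝ) ≤ D n := by linarith
    exact_mod_cast this
  set t : ℝ≥0 := (k : ℝ≥0) / (L n : ℝ≥0) with ht
  have htc : (t : ℝ) = k / L n := by rw [ht]; push_cast; rfl
  have ht1 : (t₀ : ℝ) ≤ t := by rw [htc, le_div_iff₀ hLn]; exact hk1'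
  have ht2 : (t : ℝ) ≤ t₀ + d := by rw [htc, div_le_iff₀ hLn]; exact hk2'
  have htT : t < T₀ := by
    have : (t : ℝ) < T₀ := by linarith
    exact_mod_cast this
  have hpt : 0 < (p t : ℝ) := by exact_mod_cast hI.p_pos t htT
  have hlt' := hd' t (by exact_mod_cast ht1) ht2
  have hc := hn k hkD
  rw [← ht, min_eq_left htT.le] at hc
  have hbp : b ≤ p t := by
    rw [hb, ← Real.le_log_iff_exp_le hpt]
    have : s * t ≤ |s| * T₀ := mul_le_mul (le_abs_self s) (by exact_mod_cast htT.le)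
      t.coe_nonneg (abs_nonneg s)
    linarith
  have hlow : p t * Real.exp (-(ε / 2)) ≤ ‖c k n‖ ^ (1 / (L n : ℝ)) := by
    have h1 := (abs_le.1 hc).1
    have h2 : (1 - Real.exp (-(ε / 2))) * b ≤ (1 - Real.exp (-(ε / 2))) * p t :=
      mul_le_mul_of_nonneg_left hbp (by linarith)
    linarith
  have hapow : ‖a‖ ^ k = Real.exp (t * s) ^ L n := by
    rw [← Real.exp_log ha0, ← Real.exp_nat_mul, ← Real.exp_nat_mul, ← hs, htc]
    congr 1
    field_simp
  calc Real.exp (L n * (I s - ε)) = Real.exp (I s - ε) ^ L n := by rw [← Real.exp_nat_mul]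
    _ ≤ (p t * Real.exp (-(ε / 2)) * Real.exp (t * s)) ^ L n := by
        gcongr
        calc Real.exp (I s - ε) ≤ Real.exp (Real.log (p t) + -(ε / 2) + t * s) :=
              Real.exp_le_exp.2 (by linarith)
          _ = _ := by rw [Real.exp_add, Real.exp_add, Real.exp_log hpt]
    _ ≤ (‖c k n‖ ^ (1 / (L n : ℝ)) * Real.exp (t * s)) ^ L n := by gcongr
    _ = _ := by rw [mul_pow, ← h.norm_eq_pow, hapow]

end CoeffAsymptotics

/-! ### The lower bound near a given point -/

/-- Two polynomials that are small at `m` distinct points and agree off a block of `m` consecutive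
indices have close coefficients on the block. -/
theorem exists_dist_coeff_mul_le {a : ℂ} (ha : a ≠ 0) {m : ℕ} {z : Fin m → ℂ}
    (hz : Function.Injective z) (hza : ∀ i, ‖a‖ ≤ ‖z i‖) :
    ∃ C : ℝ, 0 < C ∧ ∀ (N k₀ : ℕ) (c x x' : ℕ → ℂ) (r : ℝ), 0 ≤ r → k₀ + m ≤ N →
      (∀ i, ‖∑ k ∈ Finset.range N, x k * c k * z i ^ k‖ ≤ r) →
      (∀ i, ‖∑ k ∈ Finset.range N, x' k * c k * z i ^ k‖ ≤ r) →
      (∀ k ∉ Finset.Ico k₀ (k₀ + m), x k = x' k) →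
      ∀ k ∈ Finset.Ico k₀ (k₀ + m), dist (x k) (x' k) * (‖c k‖ * ‖a‖ ^ k) ≤ C * r := by
  obtain ⟨C, hC, hbound⟩ := exists_coeff_bound_of_injective hz
  have ha0 : 0 < ‖a‖ := norm_pos_iff.2 ha
  have hA1 : (1 : ℝ) ≤ max 1 ‖a‖ := le_max_left _ _
  -- The factor `2` is the triangle inequality for the two sums; the power of `max 1 ‖a‖` compares
  -- `‖a‖ ^ k` with `‖a‖ ^ k₀`. Nothing depends on `k₀`, which will grow with `n`.
  refine ⟨C * 2 * max 1 ‖a‖ ^ m, by positivity, fun N k₀ c x x' r hr hN hx hx' hag k hk => ?_⟩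
  have hsum : ∀ i, ‖∑ j : Fin m, (x (k₀ + j) - x' (k₀ + j)) * c (k₀ + j) * z i ^ (j : ℕ)‖ ≤
      2 * r / ‖a‖ ^ k₀ := fun i => by
    have e : ∑ k ∈ Finset.range N, x k * c k * z i ^ k -
        ∑ k ∈ Finset.range N, x' k * c k * z i ^ k =
        z i ^ k₀ * ∑ j : Fin m, (x (k₀ + j) - x' (k₀ + j)) * c (k₀ + j) * z i ^ (j : ℕ) := by
      rw [← Finset.sum_sub_distrib, ← Finset.sum_subset (s₁ := Finset.Ico k₀ (k₀ + m)),
        Finset.sum_Ico_eq_sum_range, Nat.add_sub_cancel_left, Finset.mul_sum, Finset.sum_range]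
      · refine Finset.sum_congr rfl fun j _ => ?_
        rw [pow_add]; ring
      · intro k hk
        rw [Finset.mem_Ico] at hk
        exact Finset.mem_range.2 (by omega)
      · intro k _ hk
        rw [hag k hk, sub_self]
    have h1 := norm_sub_le (∑ k ∈ Finset.range N, x k * c k * z i ^ k)
      (∑ k ∈ Finset.range N, x' k * c k * z i ^ k)
    rw [e, norm_mul, norm_pow] at h1
    rw [le_div_iff₀ (by positivity), mul_comm]
    calc _ ≤ ‖z i‖ ^ k₀ * ‖∑ j : Fin m, (x (k₀ + j) - x' (k₀ + j)) * c (k₀ + j) * z i ^ (j : ℕ)‖ := by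
          gcongr; exact hza i
      _ ≤ _ := by linarith [hx i, hx' i]
  obtain ⟨hk1, hk2⟩ := Finset.mem_Ico.1 hk
  have h2 := hbound (fun j => (x (k₀ + j) - x' (k₀ + j)) * c (k₀ + j)) _ (by positivity) hsum
    ⟨k - k₀, by omega⟩
  simp only [Nat.add_sub_cancel' hk1] at h2
  rw [norm_mul, ← dist_eq_norm] at h2
  have hpow : ‖a‖ ^ k ≤ ‖a‖ ^ k₀ * max 1 ‖a‖ ^ m := by
    rw [← Nat.add_sub_cancel' hk1, pow_add]
    refine mul_le_mul_of_nonneg_left ?_ (by positivity)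
    exact (pow_le_pow_left₀ (norm_nonneg _) (le_max_right _ _) _).trans
      (pow_le_pow_right₀ hA1 (by omega))
  calc dist (x k) (x' k) * (‖c k‖ * ‖a‖ ^ k)
      ≤ dist (x k) (x' k) * ‖c k‖ * (‖a‖ ^ k₀ * max 1 ‖a‖ ^ m) := by
        rw [← mul_assoc]; gcongr
    _ ≤ C * (2 * r / ‖a‖ ^ k₀) * (‖a‖ ^ k₀ * max 1 ‖a‖ ^ m) := by gcongr
    _ = _ := by field_simp

/-- The points lie on the outward ray through `a`: moduli at least `‖a‖` are needed to divide out
the common factor `z i ^ k₀`. -/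
theorem exists_injective_points_near {a : ℂ} (ha : a ≠ 0) {η : ℝ} (hη : 0 < η) (m : ℕ) :
    ∃ z : Fin m → ℂ, Function.Injective z ∧ (∀ i, ‖a‖ ≤ ‖z i‖) ∧ ∀ i, z i ∈ Metric.ball a η := by
  have ha0 : 0 < ‖a‖ := norm_pos_iff.2 ha
  refine ⟨fun i => a * ((1 + η / ‖a‖ * ((i : ℕ) / m : ℝ) : ℝ) : ℂ), ?_, fun i => ?_, fun i => ?_⟩
  · intro i j hij
    have hm : (m : ℝ) ≠ 0 := by
      have := i.pos
      positivity
    have h1 := mul_left_cancel₀ ha hij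
    rw [Complex.ofReal_inj] at h1
    have h2 := mul_left_cancel₀ (by positivity : η / ‖a‖ ≠ 0) (add_left_cancel h1)
    rw [div_left_inj' hm] at h2
    exact Fin.ext (by exact_mod_cast h2)
  · rw [norm_mul, Complex.norm_real, Real.norm_of_nonneg (by positivity)]
    have : 0 ≤ η / ‖a‖ * ((i : ℕ) / m : ℝ) := by positivity
    nlinarith
  · have hi : ((i : ℕ) : ℝ) / m < 1 := by
      have h1 := i.isLt
      have hm : (0 : ℝ) < m := by exact_mod_cast i.pos
      rw [div_lt_one hm]
      exact_mod_cast h1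
    rw [Metric.mem_ball, dist_eq_norm]
    have : a * ((1 + η / ‖a‖ * ((i : ℕ) / m : ℝ) : ℝ) : ℂ) - a =
        a * ((η / ‖a‖ * ((i : ℕ) / m : ℝ) : ℝ) : ℂ) := by push_cast; ring
    rw [this, norm_mul, Complex.norm_real, Real.norm_of_nonneg (by positivity)]
    calc ‖a‖ * (η / ‖a‖ * ((i : ℕ) / m)) = η * ((i : ℕ) / m) := by field_simp
      _ < η * 1 := by gcongr
      _ = η := mul_one η

/-- With probability tending to one, the random polynomial is not exponentially smaller than
expected on the whole of a given disc. -/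
theorem CoeffAsymptotics.tendsto_measure_forall_norm_le {Ω : Type*} [MeasurableSpace Ω]
    {P : Measure Ω} [IsProbabilityMeasure P] {ξ : ℕ → Ω → ℂ} (hm : ∀ k, Measurable (ξ k))
    (hind : iIndepFun ξ P) {ρ : ℝ} (hρ : 0 < ρ) {q : ℝ≥0∞} (hq1 : q < 1)
    (hq : ∀ k x, P {ω | ξ k ω ∈ Metric.closedBall x ρ} ≤ q)
    {p : ℝ≥0 → ℝ≥0} {T₀ : ℝ≥0} {L D : ℕ → ℕ} {c : ℕ → ℕ → ℂ} {I : ℝ → ℝ}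
    (h : CoeffAsymptotics p T₀ L D c) (hI : IsLogTransform p T₀ I)
    {a : ℂ} (ha : a ≠ 0) {η ε : ℝ} (hη : 0 < η) (hε : 0 < ε) :
    Tendsto (fun n => P {ω | ∀ z ∈ Metric.ball a η,
      ‖∑ k ∈ Finset.range (D n + 1), ξ k ω * c k n * z ^ k‖ ≤
        Real.exp (L n * (I (Real.log ‖a‖) - ε))}) atTop (𝓝 0) := by
  rw [ENNReal.tendsto_nhds_zero]
  intro τ hτ
  -- The block length `m` is fixed by `q ^ m ≤ τ` before the nodes and `C`, so `C` does not vary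
  -- with `n`.
  obtain ⟨m, hm'⟩ := ((ENNReal.tendsto_pow_atTop_nhds_zero_of_lt_one hq1).eventually_le_const hτ).exists
  obtain ⟨z, hz, hza, hzη⟩ := exists_injective_points_near ha hη m
  obtain ⟨C, hC, hdist⟩ := exists_dist_coeff_mul_le ha hz hza
  -- The event loses `ε` in the exponent and the block only `ε / 2`; the surplus shrinks the
  -- admissible discs below radius `ρ`.
  have hlim : Tendsto (fun n => C * Real.exp (-(ε / 2 * L n))) atTop (𝓝 0) := by
    have h1 := (h.tendsto_L_real.const_mul_atTop (show 0 < ε / 2 by positivity))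
    simpa using (Real.tendsto_exp_neg_atTop_nhds_zero.comp h1).const_mul C
  filter_upwards [h.eventually_exists_window hI ha (show 0 < ε / 2 by positivity) m,
    hlim.eventually_le_const hρ] with n hn hCn
  obtain ⟨k₀, hk₀, hk⟩ := hn
  set r := Real.exp (L n * (I (Real.log ‖a‖) - ε)) with hr
  set B : Set (ℕ → ℂ) := {x | ∀ i, ‖∑ k ∈ Finset.range (D n + 1), x k * c k n * z i ^ k‖ ≤ r}
  have hB : MeasurableSet B := by
    refine MeasurableSet.congr (MeasurableSet.iInter fun i : Fin m => measurableSet_le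
      (f := fun x : ℕ → ℂ => ‖∑ k ∈ Finset.range (D n + 1), x k * c k n * z i ^ k‖)
      (g := fun _ => r) ?_ measurable_const) (by ext x; simp [B])
    exact (Finset.measurable_fun_sum _ fun k _ => by fun_prop).norm
  have hle : P {ω | (fun k => ξ k ω) ∈ B} ≤ q ^ (Finset.Ico k₀ (k₀ + m)).card := by
    refine measure_mem_le_pow_of_sections hm hind hq hB (N := D n + 1) ?_ ?_
    · intro x x' hxx' hx i
      have e : ∑ k ∈ Finset.range (D n + 1), x' k * c k n * z i ^ k =
          ∑ k ∈ Finset.range (D n + 1), x k * c k n * z i ^ k :=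
        Finset.sum_congr rfl fun k hk => by rw [hxx' k (Finset.mem_range.1 hk)]
      rw [e]
      exact hx i
    · intro x hx x' hx' hag k hkT
      have h1 := hdist (D n + 1) k₀ (fun k => c k n) x x' r (Real.exp_nonneg _) hk₀ hx hx' hag k hkT
      obtain ⟨hk1, hk2⟩ := Finset.mem_Ico.1 hkT
      have h2 := hk k hk1 hk2
      have h3 : dist (x k) (x' k) * Real.exp (L n * (I (Real.log ‖a‖) - ε / 2)) ≤ C * r :=
        (mul_le_mul_of_nonneg_left h2 dist_nonneg).trans h1
      rw [← le_div_iff₀ (Real.exp_pos _), mul_div_assoc, hr, ← Real.exp_sub] at h3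
      refine h3.trans (le_trans (le_of_eq ?_) hCn)
      ring_nf
  rw [Nat.card_Ico, Nat.add_sub_cancel_left] at hle
  refine (measure_mono ?_).trans (hle.trans hm')
  intro ω hω i
  exact hω (z i) (hzη i)

/-! ### From good points to closeness in mean -/

/-- A square grid of spacing `η / 2`. The total area bound must be free of `η`, since the mesh is
chosen only after the tolerance. -/
theorem exists_finset_cover_ball {R : ℝ} (hR : 0 < R) {η : ℝ} (hη : 0 < η) (hη1 : η ≤ 1) :
    ∃ S : Finset ℂ, (∀ a ∈ S, a ≠ 0 ∧ ‖a‖ < R + η) ∧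
      (∀ z ∈ Metric.ball (0 : ℂ) R, ∃ a ∈ S, z ∈ Metric.ball a η) ∧
      (S.card : ℝ) * η ^ 2 ≤ (4 * R + 6) ^ 2 := by
  classical
  set M : ℤ := ⌈2 * R / η⌉ with hM
  have hM0 : 0 ≤ M := Int.ceil_nonneg (by positivity)
  -- The shift by one half keeps the grid off the axes, hence every centre away from `0`.
  set f : ℤ → ℝ := fun j => η / 2 * (j + 1 / 2) with hf
  have hf0 : ∀ j, f j ≠ 0 := fun j => by
    refine mul_ne_zero (by positivity) fun h => ?_
    have h2 : ((2 * j + 1 : ℤ) : ℝ) = 0 := by push_cast; linarith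
    have h3 : (2 * j + 1 : ℤ) = 0 := by exact_mod_cast h2
    omega
  have hclose : ∀ x : ℝ, |x| ≤ R → ∃ j ∈ Finset.Icc (-M - 1) M, |x - f j| ≤ η / 4 := fun x hx => by
    obtain ⟨hx1, hx2⟩ := abs_le.1 hx
    have hle := Int.floor_le (2 * x / η)
    have hlt := Int.lt_floor_add_one (2 * x / η)
    have hceil := Int.le_ceil (2 * R / η)
    rw [le_div_iff₀ hη] at hle
    rw [div_lt_iff₀ hη] at hlt
    rw [div_le_iff₀ hη] at hceil
    refine ⟨⌊2 * x / η⌋, Finset.mem_Icc.2 ⟨?_, ?_⟩, ?_⟩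
    · have h : (-M : ℝ) < ⌊2 * x / η⌋ + 1 := by
        by_contra! h
        nlinarith
      have h' : -M < ⌊2 * x / η⌋ + 1 := by exact_mod_cast h
      omega
    · have h : ((⌊2 * x / η⌋ : ℤ) : ℝ) ≤ M := by
        by_contra! h
        nlinarith
      exact_mod_cast h
    · rw [hf, abs_le]
      constructor <;> linarith
  set S₀ : Finset ℂ := (Finset.Icc (-M - 1) M ×ˢ Finset.Icc (-M - 1) M).image
    fun j => (⟨f j.1, f j.2⟩ : ℂ) with hS₀
  refine ⟨S₀.filter fun a => ‖a‖ < R + η, fun a ha => ?_, fun z hz => ?_, ?_⟩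
  · obtain ⟨ha1, ha2⟩ := Finset.mem_filter.1 ha
    obtain ⟨j, _, rfl⟩ := Finset.mem_image.1 ha1
    exact ⟨fun h => hf0 j.1 (congrArg Complex.re h), ha2⟩
  · rw [mem_ball_zero_iff] at hz
    obtain ⟨j, hj, hj'⟩ := hclose z.re ((Complex.abs_re_le_norm z).trans hz.le)
    obtain ⟨k, hk, hk'⟩ := hclose z.im ((Complex.abs_im_le_norm z).trans hz.le)
    have hd : ‖z - (⟨f j, f k⟩ : ℂ)‖ < η := by
      refine (Complex.norm_le_abs_re_add_abs_im _).trans_lt ?_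
      simp only [Complex.sub_re, Complex.sub_im]
      linarith
    refine ⟨⟨f j, f k⟩, Finset.mem_filter.2 ⟨Finset.mem_image.2 ⟨(j, k), ?_, rfl⟩, ?_⟩, ?_⟩
    · exact Finset.mem_product.2 ⟨hj, hk⟩
    · have := norm_le_norm_add_norm_sub z (⟨f j, f k⟩ : ℂ)
      linarith
    · rwa [Metric.mem_ball, dist_eq_norm]
  · have hcard : ((S₀.filter fun a => ‖a‖ < R + η).card : ℝ) ≤ (2 * M + 2) ^ 2 := by
      have h1 : (S₀.filter fun a => ‖a‖ < R + η).card ≤ (2 * M + 2).toNat ^ 2 := by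
        refine (Finset.card_filter_le _ _).trans (Finset.card_image_le.trans ?_)
        rw [Finset.card_product, Int.card_Icc, sq]
        have : (M + 1 - (-M - 1)).toNat = (2 * M + 2).toNat := by congr 1; ring
        rw [this]
      have h2 : (((2 * M + 2).toNat : ℤ) : ℝ) = 2 * M + 2 := by
        rw [Int.toNat_of_nonneg (by omega)]; push_cast; ring
      have h3 : (((2 * M + 2).toNat : ℕ) : ℝ) = 2 * M + 2 := by exact_mod_cast h2
      rw [← h3]
      exact_mod_cast h1
    have hMη : (2 * M + 2) * η ≤ 4 * R + 6 := by
      have := Int.ceil_lt_add_one (2 * R / η)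
      have h2 : (M : ℝ) * η ≤ 2 * R + η := by
        have h3 : (M : ℝ) ≤ 2 * R / η + 1 := this.le
        calc (M : ℝ) * η ≤ (2 * R / η + 1) * η := by gcongr
          _ = _ := by field_simp
      linarith
    have hM0' : (0 : ℝ) ≤ M := by exact_mod_cast hM0
    calc _ ≤ ((2 * M + 2) ^ 2 : ℝ) * η ^ 2 := by gcongr
      _ = ((2 * M + 2) * η) ^ 2 := by ring
      _ ≤ _ := by gcongr

/-- A subharmonic function `log ‖q‖ / ℓ` which is nowhere much larger than `U`, and not much smaller
than `U` near each centre of a fine cover, is close to `U` in mean. -/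
theorem setIntegral_abs_log_sub_le {q : ℂ[X]} {U : ℂ → ℝ} (hU : Continuous U) {ℓ ε η R R' : ℝ}
    (hℓ : 0 < ℓ) (hη : 0 < η) (hε : 0 < ε) (hR : 0 < R) {S : Finset ℂ}
    (hup : ∀ z, z ≠ 0 → ‖z‖ ≤ R' → ‖q.eval z‖ ≤ Real.exp (ℓ * (U z + ε)))
    (hcover : ∀ z ∈ Metric.ball (0 : ℂ) R, ∃ a ∈ S, z ∈ Metric.ball a η) (hRR' : R ≤ R')
    (hS : ∀ a ∈ S, ‖a‖ + 3 * η ≤ R')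
    (hlow : ∀ a ∈ S, ∃ z ∈ Metric.ball a η, Real.exp (ℓ * (U a - ε)) < ‖q.eval z‖)
    (hosc : ∀ a ∈ S, ∀ x ∈ Metric.ball a (3 * η), U x ≤ U a + ε) :
    q ≠ 0 ∧ ∫ z in Metric.ball 0 R, |ℓ⁻¹ * Real.log ‖q.eval z‖ - U z| ≤
      (12 * Real.pi * (S.card * η ^ 2) + Real.pi * R ^ 2) * ε := by
  have hq : q ≠ 0 := by
    obtain ⟨a, ha, _⟩ := hcover 0 (Metric.mem_ball_self hR)
    obtain ⟨z, _, hz⟩ := hlow a ha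
    rintro rfl
    simp only [eval_zero, norm_zero] at hz
    exact absurd hz (not_lt.2 (Real.exp_nonneg _))
  refine ⟨hq, ?_⟩
  have hUi : ∀ a r, IntegrableOn U (Metric.ball a r) := fun a r =>
    (hU.continuousOn.integrableOn_compact (isCompact_closedBall a r)).mono_set
      Metric.ball_subset_closedBall
  have hci : ∀ a r, IntegrableOn (fun _ : ℂ => ε) (Metric.ball a r) := fun a r =>
    integrableOn_const measure_ball_lt_top.ne
  have hui : ∀ a r, IntegrableOn (fun z => ℓ⁻¹ * Real.log ‖q.eval z‖) (Metric.ball a r) :=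
    fun a r => (integrableOn_log_norm_eval hq a r).const_mul _
  -- Being nonnegative almost everywhere on `‖z‖ ≤ R'`, the gap `V` can be integrated disc by disc
  -- over a cover without regard to overlaps.
  set V : ℂ → ℝ := fun z => U z + ε - ℓ⁻¹ * Real.log ‖q.eval z‖ with hV
  have hVi : ∀ a r, IntegrableOn V (Metric.ball a r) := fun a r =>
    ((hUi a r).add (hci a r)).sub (hui a r)
  have hVnn : ∀ᵐ z : ℂ, ‖z‖ ≤ R' → 0 ≤ V z := by
    filter_upwards [ae_eval_ne_zero hq, Measure.ae_ne volume (0 : ℂ)] with z hz hz0 hzR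
    have := (Real.log_le_iff_le_exp (norm_pos_iff.2 hz)).2 (hup z hz0 hzR)
    have h2 : ℓ⁻¹ * Real.log ‖q.eval z‖ ≤ U z + ε := by
      rw [inv_mul_le_iff₀ hℓ]; exact this
    simp only [hV]
    linarith
  choose! w hw1 hw2 using hlow
  have hwb : ∀ a ∈ S, Metric.ball (w a) (2 * η) ⊆ Metric.ball a (3 * η) := fun a ha =>
    Metric.ball_subset_ball' (by linarith [Metric.mem_ball.1 (hw1 a ha)])
  have hbR : ∀ a ∈ S, ∀ z ∈ Metric.ball a (3 * η), ‖z‖ ≤ R' := fun a ha z hz => by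
    rw [Metric.mem_ball, dist_eq_norm] at hz
    have := norm_le_norm_add_norm_sub a z
    linarith [hS a ha, norm_sub_rev a z, norm_le_norm_add_norm_sub' z a]
  -- The disc is centred at the good point, for the sub-mean value property, and has radius `2 * η`
  -- so as to contain the disc of radius `η` around `a`. The mean of `V` is at most `(U a + 2 * ε) -
  -- (U a - ε) = 3 * ε`, the area is `4 * π * η ^ 2`.
  have hdisc : ∀ a ∈ S, ∫ z in Metric.ball (w a) (2 * η), V z ≤ 12 * Real.pi * η ^ 2 * ε :=
    fun a ha => by
    have hne : q.eval (w a) ≠ 0 := by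
      rw [← norm_pos_iff]; exact (Real.exp_pos _).trans (hw2 a ha)
    have h1 := log_norm_eval_le_setIntegral_ball hne (show 0 < 2 * η by positivity)
    have h2 : ℓ * (U a - ε) < Real.log ‖q.eval (w a)‖ :=
      (Real.lt_log_iff_exp_lt (norm_pos_iff.2 hne)).2 (hw2 a ha)
    have h3 : ∫ z in Metric.ball (w a) (2 * η), (U z + ε) ≤ Real.pi * (2 * η) ^ 2 * (U a + 2 * ε) := by
      rw [← measure_ball_toReal (w a) (show 0 ≤ 2 * η by positivity)]
      calc _ ≤ ∫ z in Metric.ball (w a) (2 * η), (U a + 2 * ε) := by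
            refine setIntegral_mono_on ((hUi _ _).add (hci _ _))
              (integrableOn_const measure_ball_lt_top.ne) Metric.isOpen_ball.measurableSet
              fun z hz => ?_
            linarith [hosc a ha z (hwb a ha hz)]
        _ = _ := by rw [setIntegral_const, smul_eq_mul]; rfl
    have hsub : ∫ z in Metric.ball (w a) (2 * η), V z = (∫ z in Metric.ball (w a) (2 * η), (U z + ε)) -
        ℓ⁻¹ * ∫ z in Metric.ball (w a) (2 * η), Real.log ‖q.eval z‖ := by
      rw [← integral_const_mul]
      exact integral_sub ((hUi _ _).add (hci _ _)) (hui _ _)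
    have h4 : Real.pi * (2 * η) ^ 2 * (U a - ε) ≤
        ℓ⁻¹ * ∫ z in Metric.ball (w a) (2 * η), Real.log ‖q.eval z‖ := by
      rw [le_inv_mul_iff₀ hℓ]
      refine le_trans ?_ h1
      have := mul_le_mul_of_nonneg_left h2.le (show 0 ≤ Real.pi * (2 * η) ^ 2 by positivity)
      linarith
    rw [hsub]
    linarith
  have hVint : ∫ z in Metric.ball 0 R, V z ≤ S.card * (12 * Real.pi * η ^ 2 * ε) := by
    have hi : ∀ a, Integrable ((Metric.ball (w a) (2 * η)).indicator V) := fun a =>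
      (hVi _ _).integrable_indicator Metric.isOpen_ball.measurableSet
    calc ∫ z in Metric.ball 0 R, V z = ∫ z, (Metric.ball 0 R).indicator V z :=
          (integral_indicator Metric.isOpen_ball.measurableSet).symm
      _ ≤ ∫ z, ∑ a ∈ S, (Metric.ball (w a) (2 * η)).indicator V z := by
          refine integral_mono_ae ((hVi _ _).integrable_indicator Metric.isOpen_ball.measurableSet)
            (integrable_finsetSum _ fun a _ => hi a) ?_
          filter_upwards [hVnn] with z hz
          have hnn : ∀ a ∈ S, 0 ≤ (Metric.ball (w a) (2 * η)).indicator V z := fun a ha =>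
            Set.indicator_apply_nonneg fun h => hz (hbR a ha z (hwb a ha h))
          by_cases hzR : z ∈ Metric.ball (0 : ℂ) R
          · obtain ⟨a, ha, hza⟩ := hcover z hzR
            rw [Set.indicator_of_mem hzR]
            refine le_trans (le_of_eq ?_) (Finset.single_le_sum hnn ha)
            rw [Set.indicator_of_mem]
            rw [Metric.mem_ball] at hza ⊢
            have := Metric.mem_ball'.1 (hw1 a ha)
            linarith [dist_triangle z a (w a)]
          · rw [Set.indicator_of_notMem hzR]
            exact Finset.sum_nonneg hnn
      _ = ∑ a ∈ S, ∫ z in Metric.ball (w a) (2 * η), V z := by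
          rw [integral_finsetSum _ fun a _ => hi a]
          simp_rw [integral_indicator Metric.isOpen_ball.measurableSet]
      _ ≤ ∑ a ∈ S, 12 * Real.pi * η ^ 2 * ε := Finset.sum_le_sum hdisc
      _ = _ := by simp
  calc ∫ z in Metric.ball 0 R, |ℓ⁻¹ * Real.log ‖q.eval z‖ - U z|
      ≤ ∫ z in Metric.ball 0 R, (V z + ε) := by
        refine integral_mono_ae ((hui _ _).sub (hUi _ _)).abs ((hVi _ _).add (hci _ _)) ?_
        filter_upwards [ae_restrict_of_ae hVnn,
          ae_restrict_mem Metric.isOpen_ball.measurableSet] with z hz hzR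
        have hz' := hz ((mem_ball_zero_iff.1 hzR).le.trans hRR')
        simp only [hV] at hz' ⊢
        rw [abs_le]
        constructor <;> linarith
    _ = (∫ z in Metric.ball 0 R, V z) + Real.pi * R ^ 2 * ε := by
        rw [integral_add (hVi _ _) (hci _ _), setIntegral_const, smul_eq_mul, Measure.real,
          measure_ball_toReal _ hR.le]
    _ ≤ _ := by linarith

/-! ### Convergence in probability -/

theorem eval_randomPoly {Ω : Type*} (ξ : ℕ → Ω → ℂ) (c : ℕ → ℂ) (d : ℕ) (ω : Ω) (z : ℂ) :
    (randomPoly ξ c d ω).eval z = ∑ k ∈ Finset.range (d + 1), ξ k ω * c k * z ^ k := by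
  simp [randomPoly, eval_finsetSum]

theorem natDegree_randomPoly_le {Ω : Type*} (ξ : ℕ → Ω → ℂ) (c : ℕ → ℂ) (d : ℕ) (ω : Ω) :
    (randomPoly ξ c d ω).natDegree ≤ d := by
  refine natDegree_sum_le_of_forall_le _ _ fun k hk => (natDegree_C_mul_X_pow_le _ _).trans ?_
  rw [Finset.mem_range] at hk
  omega

/-- Linear statistics of zeros are controlled by the mean distance between potentials. -/
theorem abs_smul_sum_roots_sub_integral_le {I : ℝ → ℝ} {ν : Measure ℝ} [IsFiniteMeasure ν]
    (hν : ∀ s t, I t - I s = ∫ v in s..t, ν.real (Set.Iio v))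
    {φ : ℂ → ℝ} {R r ε C : ℝ} (hr : 0 < r)
    (hφ : Continuous φ) (hsupp : ∀ a, R ≤ ‖a‖ → φ a = 0) (hC : ∀ z, ‖φ z‖ ≤ C)
    (hosc : ∀ a b, dist a b < r → |φ a - φ b| ≤ ε) {q : ℂ[X]} (hq : q ≠ 0) {ℓ K : ℝ} (hℓ : 0 < ℓ)
    (hdeg : (q.natDegree : ℝ) ≤ K * ℓ) {U : ℂ → ℝ} (hUI : ∀ z, z ≠ 0 → U z = I (Real.log ‖z‖))
    (hU : Continuous U) :
    |ℓ⁻¹ * (q.roots.map φ).sum - ∫ z, φ z ∂(radialMeasure ν)| ≤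
      ε * (K + ν.real Set.univ) + 2 * (Real.pi * r ^ 2) * C / (∫ v, logDefect r v) *
        ∫ z in Metric.ball 0 (R + r), |ℓ⁻¹ * Real.log ‖q.eval z‖ - U z| := by
  set cr := ∫ v, logDefect r v with hcr
  have hcr0 : 0 < cr := integral_logDefect_pos hr
  set g := meanDefect r φ with hg
  have hε : 0 ≤ ε := (abs_nonneg _).trans (hosc 0 0 (by simpa using hr))
  obtain ⟨hgI, hB⟩ := abs_integral_meanDefect_mul_sub_integral_radialMeasure_le hν hr hφ hsupp hosc
  have hA := abs_integral_meanDefect_mul_log_eval_sub_le hr hφ hsupp hosc hq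
  have hgl := integrable_meanDefect_mul hr.le hφ hsupp (integrableOn_log_norm_eval hq 0 (R + r))
  rw [← hg, ← hcr] at hA hB
  rw [← hg] at hgI hgl
  have hUi : IntegrableOn U (Metric.ball 0 (R + r)) :=
    (hU.continuousOn.integrableOn_compact (isCompact_closedBall 0 _)).mono_set
      Metric.ball_subset_closedBall
  have hdi : IntegrableOn (fun z => ℓ⁻¹ * Real.log ‖q.eval z‖ - U z) (Metric.ball 0 (R + r)) :=
    ((integrableOn_log_norm_eval hq _ _).const_mul _).sub hUi
  have hD : |ℓ⁻¹ * (∫ z, g z * Real.log ‖q.eval z‖) - ∫ z, g z * I (Real.log ‖z‖)| ≤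
      2 * (Real.pi * r ^ 2) * C *
        ∫ z in Metric.ball 0 (R + r), |ℓ⁻¹ * Real.log ‖q.eval z‖ - U z| := by
    rw [← integral_const_mul, ← integral_sub (hgl.const_mul _) hgI, ← Real.norm_eq_abs,
      ← integral_const_mul, ← integral_indicator Metric.isOpen_ball.measurableSet]
    refine norm_integral_le_of_norm_le ?_ ?_
    · exact IntegrableOn.integrable_indicator (hdi.abs.const_mul _) Metric.isOpen_ball.measurableSet
    · filter_upwards [Measure.ae_ne volume (0 : ℂ)] with z hz
      have e : ℓ⁻¹ * (g z * Real.log ‖q.eval z‖) - g z * I (Real.log ‖z‖) =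
          g z * (ℓ⁻¹ * Real.log ‖q.eval z‖ - U z) := by rw [hUI z hz]; ring
      rw [e, norm_mul, Real.norm_eq_abs (ℓ⁻¹ * _ - _)]
      by_cases hzR : z ∈ Metric.ball (0 : ℂ) (R + r)
      · rw [Set.indicator_of_mem hzR]
        exact mul_le_mul_of_nonneg_right (norm_meanDefect_le hr.le hC z) (abs_nonneg _)
      · rw [Set.indicator_of_notMem hzR, hg, meanDefect_eq_zero hr.le hsupp (by simpa using hzR)]
        simp
  set Δ := ∫ z in Metric.ball 0 (R + r), |ℓ⁻¹ * Real.log ‖q.eval z‖ - U z|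
  set Gq := ∫ z, g z * Real.log ‖q.eval z‖
  set GI := ∫ z, g z * I (Real.log ‖z‖)
  set Z := (q.roots.map φ).sum
  set m := ∫ z, φ z ∂(radialMeasure ν)
  have hA' : |ℓ⁻¹ * Gq - cr * (ℓ⁻¹ * Z)| ≤ ε * cr * K := by
    have : ℓ⁻¹ * Gq - cr * (ℓ⁻¹ * Z) = ℓ⁻¹ * (Gq - cr * Z) := by ring
    rw [this, abs_mul, abs_of_pos (inv_pos.2 hℓ), inv_mul_le_iff₀ hℓ]
    refine hA.trans ?_
    have := mul_le_mul_of_nonneg_left hdeg (show 0 ≤ ε * cr by positivity)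
    linarith
  have hfin : cr * |ℓ⁻¹ * Z - m| ≤ ε * cr * K + ε * cr * ν.real Set.univ +
      2 * (Real.pi * r ^ 2) * C * Δ := by
    rw [← abs_of_pos hcr0, ← abs_mul, abs_of_pos hcr0]
    rw [abs_le] at *
    constructor <;> linarith [hA'.1, hA'.2, hB.1, hB.2, hD.1, hD.2]
  rw [← mul_le_mul_iff_right₀ hcr0]
  refine hfin.trans (le_of_eq ?_)
  field_simp

/-- The order of choices matters: `r` from the modulus of continuity of `φ`, then `ε` against
constants depending on `r`, then the mesh `η` from the modulus of continuity of `U`. The cover is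
thus finite and independent of `n`, so finitely many vanishing exceptional events remain, and off
them the estimate is deterministic. -/
theorem CoeffAsymptotics.convergesInProbability {Ω : Type*} [MeasurableSpace Ω] {P : Measure Ω}
    [IsProbabilityMeasure P] {ξ : ℕ → Ω → ℂ} (hm : ∀ k, Measurable (ξ k)) (hind : iIndepFun ξ P)
    (hident : ∀ k, IdentDistrib (ξ k) (ξ 0) P P)
    (hnondeg : ¬ ∃ a : ℂ, ∀ᵐ ω ∂P, ξ 0 ω = a)
    (hlog : Integrable (fun ω => Real.log (1 + ‖ξ 0 ω‖)) P)
    {p : ℝ≥0 → ℝ≥0} {T₀ : ℝ≥0} {L D : ℕ → ℕ} {c : ℕ → ℕ → ℂ} {I : ℝ → ℝ}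
    (h : CoeffAsymptotics p T₀ L D c) (hI : IsLogTransform p T₀ I)
    {K : ℕ} (hD : ∀ n, D n + 1 ≤ K * L n)
    {ν : Measure ℝ} [IsFiniteMeasure ν]
    (hν : ∀ s t, I t - I s = ∫ v in s..t, ν.real (Set.Iio v)) :
    ConvergesInProbability P
      (fun n ω => ((L n : ℝ≥0∞)⁻¹) • zeroMeasure (randomPoly ξ (fun k => c k n) (D n) ω))
      (radialMeasure ν) := by
  intro φ hφs hφc
  have hφ : Continuous φ := hφs.continuous
  obtain ⟨C, hC⟩ := hφc.exists_bound_of_continuous hφ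
  have hC0 : 0 ≤ C := (norm_nonneg _).trans (hC 0)
  obtain ⟨R₀, hR₀⟩ := hφc.isCompact.isBounded.subset_closedBall 0
  set R := max R₀ 0 + 1 with hR
  have hR0 : 0 < R := by positivity
  have hsupp : ∀ a, R ≤ ‖a‖ → φ a = 0 := fun a ha => by
    by_contra hne
    have h1 := hR₀ (subset_tsupport _ hne)
    rw [mem_closedBall_zero_iff] at h1
    linarith [le_max_left R₀ 0]
  -- the small ball estimate
  obtain ⟨ρ, hρ, q, hq1, hq⟩ : ∃ ρ : ℝ, 0 < ρ ∧ ∃ q : ℝ≥0∞, q < 1 ∧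
      ∀ k x, P {ω | ξ k ω ∈ Metric.closedBall x ρ} ≤ q := by
    have := Measure.isProbabilityMeasure_map (hm 0).aemeasurable (μ := P)
    obtain ⟨ρ, hρ, q, hq1, hq⟩ := exists_closedBall_le_of_nondegenerate (P.map (ξ 0)) (by
      rintro ⟨a, ha⟩
      exact hnondeg ⟨a, ae_of_ae_map (hm 0).aemeasurable ha⟩)
    refine ⟨ρ, hρ, q, hq1, fun k x => ?_⟩
    have h1 := (hident k).measure_mem_eq (Metric.isClosed_closedBall (x := x) (ε := ρ)).measurableSet
    refine (le_of_eq h1).trans ((le_of_eq ?_).trans (hq x))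
    rw [Measure.map_apply (hm 0) Metric.isClosed_closedBall.measurableSet]
  rw [tendstoInMeasure_iff_dist]
  intro τ hτ
  set W := (K : ℝ) + ν.real Set.univ + 1 with hW
  have hW0 : 0 < W := by positivity
  -- Two errors get `τ / 3` each; the remaining third makes the final inequality strict.
  set ε₁ := τ / (3 * W) with hε₁
  have hε₁0 : 0 < ε₁ := by positivity
  obtain ⟨r, hr, hosc⟩ := Metric.uniformContinuous_iff.1
    (hφc.uniformContinuous_of_continuous hφ) ε₁ hε₁0
  have hosc' : ∀ a b, dist a b < r → |φ a - φ b| ≤ ε₁ := fun a b hab => by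
    have := hosc hab
    rw [Real.dist_eq] at this
    exact this.le
  have hcr := integral_logDefect_pos hr
  set Q := 2 * (Real.pi * r ^ 2) * C / ∫ v, logDefect r v with hQ
  have hQ0 : 0 ≤ Q := by positivity
  set A := 12 * Real.pi * (4 * (R + r) + 6) ^ 2 + Real.pi * (R + r) ^ 2 with hA
  have hA0 : 0 < A := by positivity
  set ε := τ / (3 * (Q + 1) * A) with hε
  have hε0 : 0 < ε := by positivity
  set U := radialExtension I (Real.log (p 0)) with hUdef
  have hU : Continuous U := hI.continuous_radialExtension
  have hUI : ∀ z, z ≠ 0 → U z = I (Real.log ‖z‖) := fun z hz => if_neg hz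
  -- Centres have modulus below `R + r + 1`, and discs of radius `3 * η ≤ 3` around them must stay
  -- inside.
  set R' := R + r + 4 with hR'
  -- the mesh of the cover
  obtain ⟨d, hd, hUosc⟩ : ∃ d > 0, ∀ x ∈ Metric.closedBall (0 : ℂ) R',
      ∀ y ∈ Metric.closedBall (0 : ℂ) R', dist x y < d → dist (U x) (U y) < ε :=
    Metric.uniformContinuousOn_iff.1
      ((isCompact_closedBall (0 : ℂ) R').uniformContinuousOn_of_continuous hU.continuousOn) ε hε0
  set η := min 1 (d / 3) with hη
  have hη0 : 0 < η := by positivity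
  have hη1 : η ≤ 1 := min_le_left _ _
  have hηd : 3 * η ≤ d := by linarith [min_le_right 1 (d / 3)]
  obtain ⟨S, hS1, hS2, hS3⟩ := exists_finset_cover_ball (R := R + r) (by positivity) hη0 hη1
  have hSosc : ∀ a ∈ S, ∀ x ∈ Metric.ball a (3 * η), U x ≤ U a + ε := fun a ha x hx => by
    rw [Metric.mem_ball, dist_eq_norm] at hx
    have h1 := (hS1 a ha).2
    have h2 : ‖x‖ ≤ R' := by
      linarith [norm_le_norm_add_norm_sub' x a]
    have := hUosc x (by simpa using h2) a (by rw [mem_closedBall_zero_iff]; linarith)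
      (by rw [dist_eq_norm]; linarith)
    rw [Real.dist_eq] at this
    linarith [le_abs_self (U x - U a)]
  -- the exceptional events
  set E : ℕ → Set Ω := fun n => {ω | ∃ k ≤ D n, Real.exp (ε / 3 * L n) < ‖ξ k ω‖} with hE
  set F : ℂ → ℕ → Set Ω := fun a n => {ω | ∀ z ∈ Metric.ball a η,
      ‖∑ k ∈ Finset.range (D n + 1), ξ k ω * c k n * z ^ k‖ ≤
        Real.exp (L n * (I (Real.log ‖a‖) - ε))} with hF
  have hElim : Tendsto (fun n => P (E n)) atTop (𝓝 0) :=
    tendsto_measure_exists_exp_lt hm hident hlog h.tendsto_L hD (by positivity)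
  have hFlim : ∀ a ∈ S, Tendsto (fun n => P (F a n)) atTop (𝓝 0) := fun a ha =>
    h.tendsto_measure_forall_norm_le hm hind hρ hq1 hq hI (hS1 a ha).1 hη0 hε0
  have hlim : Tendsto (fun n => P (E n) + ∑ a ∈ S, P (F a n)) atTop (𝓝 0) := by
    have := hElim.add (tendsto_finsetSum S hFlim)
    simpa using this
  refine tendsto_of_tendsto_of_tendsto_of_le_of_le' tendsto_const_nhds hlim
    (Eventually.of_forall fun _ => zero_le) ?_
  filter_upwards [h.eventually_norm_sum_le hI hε0 (show 1 ≤ R' by linarith)] with n hn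
  refine le_trans (measure_mono (t := E n ∪ ⋃ a ∈ S, F a n) ?_)
    ((measure_union_le _ _).trans (add_le_add le_rfl (measure_biUnion_finset_le _ _)))
  intro ω hω
  by_contra hgood
  simp only [Set.mem_union, Set.mem_iUnion, not_or, not_exists] at hgood
  obtain ⟨hgE, hgF⟩ := hgood
  have hLn : (0 : ℝ) < L n := by exact_mod_cast h.L_pos n
  set f := randomPoly ξ (fun k => c k n) (D n) ω with hf
  have hξ : ∀ k ≤ D n, ‖ξ k ω‖ ≤ Real.exp (ε / 3 * L n) := fun k hk => by
    by_contra! hlt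
    exact hgE ⟨k, hk, hlt⟩
  obtain ⟨hf0, hint⟩ := setIntegral_abs_log_sub_le (q := f) hU hLn hη0 hε0
    (R := R + r) (R' := R') (S := S) (by positivity)
    (fun z hz hzR => by
      rw [hf, eval_randomPoly, hUI z hz]
      exact hn (fun k => ξ k ω) hξ z hz hzR)
    hS2 (by linarith) (fun a ha => by linarith [(hS1 a ha).2])
    (fun a ha => by
      have h1 := hgF a ha
      simp only [hF, Set.mem_ofPred_eq] at h1
      push Not at h1
      obtain ⟨z, hz, hlt⟩ := h1
      refine ⟨z, hz, ?_⟩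
      rwa [hf, eval_randomPoly, hUI a (hS1 a ha).1])
    hSosc
  have hdeg : (f.natDegree : ℝ) ≤ K * L n := by
    have h1 : f.natDegree ≤ K * L n := by
      have : f.natDegree ≤ D n := natDegree_randomPoly_le ξ (fun k => c k n) (D n) ω
      have := hD n
      omega
    exact_mod_cast h1
  have hmain := abs_smul_sum_roots_sub_integral_le hν hr hφ hsupp hC hosc' hf0 hLn hdeg hUI hU
  have hω : τ ≤ dist (∫ z, φ z ∂((L n : ℝ≥0∞)⁻¹ • zeroMeasure f)) (∫ z, φ z ∂(radialMeasure ν)) := hω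
  rw [integral_smul_measure, integral_zeroMeasure, ENNReal.toReal_inv, ENNReal.toReal_natCast,
    smul_eq_mul, Real.dist_eq] at hω
  have hlt1 : ε₁ * (K + ν.real Set.univ) ≤ τ / 3 := by
    calc ε₁ * (K + ν.real Set.univ) ≤ ε₁ * W := by gcongr; linarith
      _ = τ / 3 := by rw [hε₁]; field_simp
  have hlt2 : Q * ∫ z in Metric.ball 0 (R + r), |(L n : ℝ)⁻¹ * Real.log ‖f.eval z‖ - U z| ≤
      τ / 3 := by
    calc _ ≤ (Q + 1) * (A * ε) := by
          refine mul_le_mul (by linarith) (hint.trans ?_)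
            (integral_nonneg fun _ => abs_nonneg _) (by positivity)
          rw [hA]
          gcongr
      _ = τ / 3 := by rw [hε]; field_simp
  linarith

theorem theorem2 {Ω : Type*} [MeasurableSpace Ω] (P : Measure Ω) [IsProbabilityMeasure P]
    -- nondegenerate i.i.d. complex random variables
    (ξ : ℕ → Ω → ℂ) (hξ_meas : ∀ k, Measurable (ξ k)) (hξ_indep : iIndepFun ξ P)
    (hξ_ident : ∀ k, IdentDistrib (ξ k) (ξ 0) P P)
    (hξ_nondeg : ¬ ∃ a : ℂ, ∀ᵐ ω ∂P, ξ 0 ω = a)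
    (hξ_zero : P {ω | ξ 0 ω = 0} = 0)
    (hξ_log : Integrable (fun ω => Real.log (1 + ‖ξ 0 ω‖)) P)
    -- `c k n` is the deterministic coefficient of `ξ_k z^k` in the `n`-th polynomial
    (c : ℕ → ℕ → ℂ)
    (p : ℝ≥0 → ℝ≥0) (T₀ : ℝ≥0) (hT₀ : 0 < T₀)
    (L : ℕ → ℕ) (hL_pos : ∀ n, 0 < L n) (hL : Tendsto L atTop atTop)
    (δ : ℕ → ℝ) (hδ_mem : ∀ n, δ n ∈ Set.Ioo (-(T₀ : ℝ)) (T₀ : ℝ))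
    (hδ : Tendsto δ atTop (𝓝 0))
    -- `(T₀ - δ_n) L_n` is an integer `D n`
    (D : ℕ → ℕ) (hD : ∀ n, (D n : ℝ) = ((T₀ : ℝ) - δ n) * (L n : ℝ))
    (hp_pos : ∀ t, t < T₀ → 0 < p t) (hp_zero : ∀ t, T₀ < t → p t = 0)
    (hp_cont : ContinuousOn p (Set.Icc 0 T₀))
    (hc : Tendsto
      (fun n => ⨆ k : Fin (D n + 1),
        |‖c (k : ℕ) n‖ ^ (1 / (L n : ℝ))
          - (p (min (((k : ℕ) : ℝ≥0) / (L n : ℝ≥0)) T₀) : ℝ)|)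
      atTop (𝓝 0)) :
    -- the Legendre–Fenchel transform `I` of `-log p` is finite
    ∃ I : ℝ → ℝ, (∀ s, (I s : EReal) = legendreFenchel (negLog p) s) ∧
      ∃ μ : Measure ℂ,
        IsRotationInvariant μ ∧
        -- `μ(𝔻_r)` is the left derivative of `I` at `log r`
        (∀ r : ℝ, 0 < r → μ (Metric.ball 0 r) < ∞ ∧
          HasDerivWithinAt I (μ.real (Metric.ball 0 r))
            (Set.Iio (Real.log r)) (Real.log r)) ∧
        ConvergesInProbability P
          (fun n ω => ((L n : ℝ≥0∞)⁻¹) •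
            zeroMeasure (randomPoly ξ (fun k => c k n) (D n) ω)) μ := by
  obtain ⟨I, hI, hle, hex⟩ := exists_legendreFenchel_real hT₀ hp_pos hp_zero hp_cont
  have hIT : IsLogTransform p T₀ I := ⟨hT₀, hp_pos, hp_zero, hp_cont, hle, hex⟩
  obtain ⟨ν, hνfin, hν⟩ := exists_measure_integral_Iio_eq hIT.convexOn hIT.log_p_zero_le
    hIT.monotone fun s t hst => hIT.sub_le hst
  have hratio : ∀ n, (D n : ℝ) / L n = T₀ - δ n := fun n => by
    have : (L n : ℝ) ≠ 0 := by exact_mod_cast (hL_pos n).ne'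
    rw [hD n]
    field_simp
  have hcoeff : CoeffAsymptotics p T₀ L D c := by
    refine ⟨hL_pos, hL, ?_, fun ε hε => ?_⟩
    · simp_rw [hratio]
      simpa using hδ.const_sub (T₀ : ℝ)
    · filter_upwards [hc.eventually_le_const hε] with n hn k hk
      have hbdd : BddAbove (Set.range fun k : Fin (D n + 1) => |‖c (k : ℕ) n‖ ^ (1 / (L n : ℝ))
          - (p (min (((k : ℕ) : ℝ≥0) / (L n : ℝ≥0)) T₀) : ℝ)|) := (Set.finite_range _).bddAbove
      exact (le_ciSup hbdd ⟨k, by omega⟩).trans hn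
  -- From `δ n > -T₀` the degree is at most `2 * T₀ * L n`; the extra `1` is absorbed by `L n ≥ 1`.
  have hDK : ∀ n, D n + 1 ≤ (⌈2 * (T₀ : ℝ)⌉₊ + 1) * L n := fun n => by
    have hLn : (1 : ℝ) ≤ L n := by exact_mod_cast hL_pos n
    have h1 : (D n : ℝ) ≤ ⌈2 * (T₀ : ℝ)⌉₊ * L n := by
      rw [hD n]
      have := Nat.le_ceil (2 * (T₀ : ℝ))
      have := (hδ_mem n).1
      gcongr
      linarith
    have h2 : ((D n + 1 : ℕ) : ℝ) ≤ ((⌈2 * (T₀ : ℝ)⌉₊ + 1) * L n : ℕ) := by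
      push_cast
      linarith
    exact_mod_cast h2
  refine ⟨I, hI, radialMeasure ν, isRotationInvariant_radialMeasure, fun r hr => ?_, ?_⟩
  · refine ⟨measure_lt_top _ _, ?_⟩
    rw [Measure.real, radialMeasure_ball hr]
    exact hasDerivWithinAt_Iio_of_integral_eq hν _
  · exact hcoeff.convergesInProbability hξ_meas hξ_indep hξ_ident hξ_nondeg hξ_log hIT hDK hν
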